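/- Let $x,y\ge 0$ be real, $I=[x,x+y]\subset[0,\infty)$, and let $k\ge 1$ and $l\ge 0$ be coprime integers. Let $\varphi$ be Euler's function and let $p$ denote primes. For functions on $I$ write $\|f\|_{1,I}=\int_I|f(t)|\,dt$ and $\|f\|_{\infty,I}=\sup_{t\in I}|f(t)|$. Let $W^{1,1}(I)$ be the closure of $C^1(I)$ with respect to the norm $\|f\|_{1,I}+\|f'\|_{1,I}$, regarded as a space of continuous functions on $I$; for $f\in W^{1,1}(I)$ let $f'\in L^1(I)$ denote its (weak) derivative. Put $$\rho_I(f)=\frac{\|f\|_{1,I}}{\|f\|_{\infty,I}+\|f'\|_{1,I}}\quad(f\ne 0),\qquad \rho_I(0)=0.$$ Then for every non-negative $f\in W^{1,1}(I)$ with $\rho_I(f)>k$ both inequalities $$\sum_{\substack{p\in I\\ p\equiv l \bmod k}} f(p) < \frac{2\,\|f\|_{1,I}}{\varphi(k)\log(\rho_I(f)/k)}\left(1+\frac{8}{\log(\rho_I(f)/k)}\right)$$ and $$\sum_{\substack{p\in I\\ p\equiv l \bmod k}} f(p) < \frac{3\,\|f\|_{1,I}}{\varphi(k)\log(\rho_I(f)/k)}$$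 hold. In particular (taking $f\equiv 1$), if $y>k$ and $\pi(t;k,l)$ denotes the number of primes $p\le t$ with $p\equiv l\bmod k$, then $$\pi(x+y;k,l)-\pi(x;k,l)<\frac{2y}{\varphi(k)\log(y/k)}\left(1+\frac{8}{\log(y/k)}\right).$$ -/

import Mathlib

open MeasureTheory

noncomputable section

namespace WeightedBT

/-- The norm `‖f‖_{1,I} = ∫_I |f(t)| dt` on `I = [a, b]`. -/
def norm1 (a b : ℝ) (f : ℝ → ℝ) : ℝ := ∫ t in Set.Icc a b, |f t|

/-- The norm `‖f‖_{∞,I} = sup_{t ∈ I} |f(t)|` on `I = [a, b]`, used for continuous `f`. -/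
def normSup (a b : ℝ) (f : ℝ → ℝ) : ℝ := sSup ((fun t => |f t|) '' Set.Icc a b)

/-- `f` (as a continuous function on `I = [a, b]`) is the limit of functions `u ∈ C¹(I)` in the
norm `‖u‖_{1,I} + ‖u'‖_{1,I}`, and `g ∈ L¹(I)` is the `L¹`-limit of their derivatives, that is,
`f ∈ W^{1,1}(I)` with weak derivative `f' = g`. -/
structure HasW11Deriv (a b : ℝ) (f g : ℝ → ℝ) : Prop where
  continuousOn : ContinuousOn f (Set.Icc a b)
  integrableOn : IntegrableOn g (Set.Icc a b)
  approx : ∀ ε : ℝ, 0 < ε → ∃ u : ℝ → ℝ, ContDiffOn ℝ 1 u (Set.Icc a b) ∧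
    norm1 a b (fun t => u t - f t) +
      norm1 a b (fun t => derivWithin u (Set.Icc a b) t - g t) < ε

/-- `f ∈ W^{1,1}([a, b])`, the closure of `C¹([a, b])` in the norm `‖f‖₁ + ‖f'‖₁`, regarded as a
space of continuous functions on `[a, b]`. -/
def MemW11 (a b : ℝ) (f : ℝ → ℝ) : Prop := ∃ g : ℝ → ℝ, HasW11Deriv a b f g

open Classical in
/-- The derivative `f'` of `f ∈ W^{1,1}([a, b])` (unique up to null sets, see
`HasW11Deriv.ae_unique`). -/
def w11Deriv (a b : ℝ) (f : ℝ → ℝ) : ℝ → ℝ :=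
  if h : MemW11 a b f then h.choose else 0

/-- `ρ_I(f) = ‖f‖_{1,I} / (‖f‖_{∞,I} + ‖f'‖_{1,I})` for `I = [a, b]`; when `f = 0` on `I` this is
`0 / 0 = 0`. -/
def rho (a b : ℝ) (f : ℝ → ℝ) : ℝ :=
  norm1 a b f / (normSup a b f + norm1 a b (w11Deriv a b f))

/-- The sum of `f p` over the primes `p ∈ [a, b]` with `p ≡ l mod k` (for `0 ≤ a`). -/
def primeSum (a b : ℝ) (k l : ℕ) (f : ℝ → ℝ) : ℝ :=
  ∑ p ∈ Finset.Icc ⌈a⌉₊ ⌊b⌋₊ with p.Prime ∧ p ≡ l [MOD k], f p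

/-- `π(t; k, l)`, the number of primes `p ≤ t` with `p ≡ l mod k` (for `0 ≤ t`). -/
def primePi (t : ℝ) (k l : ℕ) : ℕ :=
  (Finset.filter (fun p : ℕ => p.Prime ∧ p ≡ l [MOD k]) (Finset.Icc 1 ⌊t⌋₊)).card

/-- Integration by parts against a test function passes to the limit. -/
theorem HasW11Deriv.integral_mul {a b : ℝ} {f g : ℝ → ℝ} (hab : a < b) (h : HasW11Deriv a b f g)
    {φ : ℝ → ℝ} (hφ : ContDiff ℝ 1 φ) (ha : φ a = 0) (hb : φ b = 0) :
    ∫ t in Set.Icc a b, φ t * g t = - ∫ t in Set.Icc a b, deriv φ t * f t := by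
  have hφ' : Continuous (deriv φ) := hφ.continuous_deriv le_rfl
  obtain ⟨M₁, hM₁⟩ := isCompact_Icc.exists_bound_of_continuousOn
    (s := Set.Icc a b) hφ.continuous.continuousOn
  obtain ⟨M₂, hM₂⟩ := isCompact_Icc.exists_bound_of_continuousOn
    (s := Set.Icc a b) hφ'.continuousOn
  have key : ∀ (ψ : ℝ → ℝ) (M : ℝ), Continuous ψ → (∀ t ∈ Set.Icc a b, ‖ψ t‖ ≤ M) →
      ∀ w : ℝ → ℝ, IntegrableOn w (Set.Icc a b) →
      IntegrableOn (fun t => ψ t * w t) (Set.Icc a b) ∧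
      |∫ t in Set.Icc a b, ψ t * w t| ≤ M * norm1 a b w := by
    intro ψ M hψ hM w hw
    refine ⟨hw.continuousOn_mul hψ.continuousOn isCompact_Icc, ?_⟩
    rw [norm1, ← integral_const_mul, ← Real.norm_eq_abs]
    refine norm_integral_le_of_norm_le (hw.abs.const_mul M) ?_
    refine (ae_restrict_mem measurableSet_Icc).mono fun t ht => ?_
    rw [norm_mul, Real.norm_eq_abs (w t)]
    exact mul_le_mul_of_nonneg_right (hM t ht) (abs_nonneg _)
  have hM₁0 : 0 ≤ M₁ := (norm_nonneg _).trans (hM₁ a ⟨le_rfl, hab.le⟩)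
  have hM₂0 : 0 ≤ M₂ := (norm_nonneg _).trans (hM₂ a ⟨le_rfl, hab.le⟩)
  have hf : IntegrableOn f (Set.Icc a b) := h.continuousOn.integrableOn_Icc
  suffices H : |(∫ t in Set.Icc a b, φ t * g t) + ∫ t in Set.Icc a b, deriv φ t * f t| ≤ 0 by
    have := abs_nonpos_iff.1 H
    linarith
  refine le_of_forall_pos_le_add fun ε hε => ?_
  have hD : 0 < M₁ + M₂ + 1 := by positivity
  obtain ⟨u, hu, hlt⟩ := h.approx (ε / (M₁ + M₂ + 1)) (by positivity)
  have hu' : ContinuousOn (derivWithin u (Set.Icc a b)) (Set.Icc a b) :=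
    hu.continuousOn_derivWithin (uniqueDiffOn_Icc hab) le_rfl
  have hui := hu.continuousOn.integrableOn_Icc (μ := volume)
  have hui' := hu'.integrableOn_Icc (μ := volume)
  have parts : (∫ t in Set.Icc a b, φ t * derivWithin u (Set.Icc a b) t) +
      ∫ t in Set.Icc a b, deriv φ t * u t = 0 := by
    have e := intervalIntegral.integral_deriv_mul_eq_sub_of_hasDerivAt (a := a) (b := b)
      (u := φ) (v := u) (u' := deriv φ) (v' := derivWithin u (Set.Icc a b))
      hφ.continuous.continuousOn (by rw [Set.uIcc_of_le hab.le]; exact hu.continuousOn)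
      (fun t _ => (hφ.differentiable one_ne_zero t).hasDerivAt)
      (fun t ht => by
        rw [min_eq_left hab.le, max_eq_right hab.le] at ht
        exact ((hu.differentiableOn one_ne_zero) t
          (Set.Ioo_subset_Icc_self ht)).hasDerivWithinAt.hasDerivAt (Icc_mem_nhds ht.1 ht.2))
      (hφ'.intervalIntegrable _ _)
      (by
        apply ContinuousOn.intervalIntegrable
        rw [Set.uIcc_of_le hab.le]; exact hu')
    rw [ha, hb, intervalIntegral.integral_of_le hab.le, ← integral_Icc_eq_integral_Ioc,
      integral_add (key _ _ hφ' hM₂ _ hui).1 (key _ _ hφ.continuous hM₁ _ hui').1] at e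
    linarith
  obtain ⟨i₁, b₁⟩ := key φ M₁ hφ.continuous hM₁ _ (hui'.sub h.integrableOn)
  obtain ⟨i₂, b₂⟩ := key (deriv φ) M₂ hφ' hM₂ _ (hui.sub hf)
  have e₁ : ∫ t in Set.Icc a b, φ t * (derivWithin u (Set.Icc a b) - g) t =
      (∫ t in Set.Icc a b, φ t * derivWithin u (Set.Icc a b) t) -
        ∫ t in Set.Icc a b, φ t * g t := by
    rw [← integral_sub (key _ _ hφ.continuous hM₁ _ hui').1
      (key _ _ hφ.continuous hM₁ _ h.integrableOn).1]
    simp only [Pi.sub_apply, mul_sub]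
  have e₂ : ∫ t in Set.Icc a b, deriv φ t * (u - f) t =
      (∫ t in Set.Icc a b, deriv φ t * u t) - ∫ t in Set.Icc a b, deriv φ t * f t := by
    rw [← integral_sub (key _ _ hφ' hM₂ _ hui).1 (key _ _ hφ' hM₂ _ hf).1]
    simp only [Pi.sub_apply, mul_sub]
  have n₁ : 0 ≤ norm1 a b (u - f) := integral_nonneg fun _ => abs_nonneg _
  have n₂ : 0 ≤ norm1 a b (derivWithin u (Set.Icc a b) - g) := integral_nonneg fun _ => abs_nonneg _
  change norm1 a b (u - f) + norm1 a b (derivWithin u (Set.Icc a b) - g) < _ at hlt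
  rw [lt_div_iff₀ hD] at hlt
  rw [e₁] at b₁
  rw [e₂] at b₂
  rw [abs_le] at b₁ b₂ ⊢
  constructor <;> nlinarith

/-- The derivative of a function in `W^{1,1}` is determined almost everywhere. -/
theorem HasW11Deriv.ae_unique {a b : ℝ} {f g h : ℝ → ℝ} (hg : HasW11Deriv a b f g)
    (hh : HasW11Deriv a b f h) : g =ᵐ[volume.restrict (Set.Icc a b)] h := by
  rw [← Measure.restrict_congr_set Ioo_ae_eq_Icc, Filter.EventuallyEq,
    ae_restrict_iff' measurableSet_Ioo]
  rcases lt_or_ge a b with hab | hab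
  swap
  · simp [Set.Ioo_eq_empty_of_le hab]
  have hi := hg.integrableOn.sub hh.integrableOn
  have := isOpen_Ioo.ae_eq_zero_of_integral_contDiff_smul_eq_zero (μ := volume) (f := g - h)
    (U := Set.Ioo a b) (hi.mono_set Set.Ioo_subset_Icc_self).locallyIntegrableOn ?_
  · filter_upwards [this] with t ht hm using sub_eq_zero.1 (ht hm)
  intro φ hφ _ hs
  have z : ∀ t, t ∉ Set.Ioo a b → φ t = 0 := fun t ht =>
    image_eq_zero_of_notMem_tsupport fun hm => ht (hs hm)
  have hφ1 : ContDiff ℝ 1 φ := hφ.of_le (by exact_mod_cast le_top)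
  have e₁ := hg.integral_mul hab hφ1 (z a (by simp)) (z b (by simp))
  have e₂ := hh.integral_mul hab hφ1 (z a (by simp)) (z b (by simp))
  rw [← setIntegral_eq_integral_of_forall_compl_eq_zero (s := Set.Icc a b)
    (fun t ht => by rw [z t fun hm => ht (Set.Ioo_subset_Icc_self hm), zero_smul])]
  simp only [Pi.sub_apply, smul_eq_mul, mul_sub]
  rw [integral_sub
    (hg.integrableOn.continuousOn_mul hφ.continuous.continuousOn isCompact_Icc)
    (hh.integrableOn.continuousOn_mul hφ.continuous.continuousOn isCompact_Icc), e₁, e₂, sub_self]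

end WeightedBT

end

/-! Put F = ‖f‖₁, E = ‖f‖_∞ + ‖f'‖₁ and L = log(ρ/k), so that E = (F/k)·e^(-L). Partial summation
against f' shows that the sum of f over any residue class mod q equals F/q up to an error of
absolute value at most E, because the counting function of the class differs from its linear
approximation by at most 1. Also f ≤ E pointwise. The sieve uses only these facts and f ≥ 0,
recorded in `IsEquidistributed`; from there on the weight behaves like an interval.

For large L, Selberg's sieve of level z = e^t with L = 2t + 4 gives main term F/(kS), where S = ∑
1/φ(n) over squarefree n ≤ z coprime to the modulus. `log_le_mul_selbergSum` bounds S below by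
(φ(k)/k)·log z. The remainder is E times (∑|λ_d|)², plus E for each small prime. The trivial bound
on λ is too weak: `selbergErrorSum_div_selbergSum_le` gives ∑|λ_d| ≤ C·z/log z uniformly in the even
modulus, using Chebyshev's bound on θ. This makes the remainder O(F/(k t²)), absorbed by the
secondary term 8/L. An odd modulus is first doubled, which keeps φ and loses only the prime 2.

For L ≤ 15.5 the asymptotic argument is too lossy. There the Legendre sieve by a few primes up to 13
proves the bound with 3/L, which for such L is the stronger of the two claims. -/

namespace WeightedBT

/-! ### Functions in W^{1,1} and their sums over arithmetic progressions -/

theorem continuousOn_primitive_Icc {a b : ℝ} {g : ℝ → ℝ} (hab : a ≤ b)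
    (hg : IntegrableOn g (Set.Icc a b)) :
    ContinuousOn (fun t => ∫ s in a..t, g s) (Set.Icc a b) := by
  rw [← Set.uIcc_of_le hab] at hg ⊢
  exact intervalIntegral.continuousOn_primitive_interval hg

/-- A function in `W^{1,1}` is the indefinite integral of its weak derivative. -/
theorem HasW11Deriv.eq_add_integral {a b : ℝ} {f g : ℝ → ℝ} (hab : a < b)
    (h : HasW11Deriv a b f g) {t : ℝ} (ht : t ∈ Set.Icc a b) :
    f t = f a + ∫ s in a..t, g s := by
  have hG : ContinuousOn (fun t => ∫ s in a..t, g s) (Set.Icc a b) :=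
    continuousOn_primitive_Icc hab.le h.integrableOn
  set H : ℝ → ℝ := fun t => f t - ∫ s in a..t, g s with hH
  have hHc : ContinuousOn H (Set.Icc a b) := h.continuousOn.sub hG
  have hHi : IntegrableOn H (Set.Icc a b) := hHc.integrableOn_Icc
  have hci : ∀ c : ℝ, IntegrableOn (fun _ => c) (Set.Icc a b) := fun c =>
    continuousOn_const.integrableOn_Icc
  have hHci : ∀ c : ℝ, IntegrableOn (fun t => |H t - c|) (Set.Icc a b) := fun c =>
    (hHi.sub (hci c)).abs
  -- For a C¹ approximant u, the function u - ∫u' is the constant u(a); hence H lies L¹-close to a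
  -- constant.
  have approx : ∀ ε : ℝ, 0 < ε → ∃ c : ℝ, ∫ t in Set.Icc a b, |H t - c| ≤ (1 + (b - a)) * ε := by
    intro ε hε
    obtain ⟨u, hu, hlt⟩ := h.approx ε hε
    refine ⟨u a, ?_⟩
    have hu' : ContinuousOn (derivWithin u (Set.Icc a b)) (Set.Icc a b) :=
      hu.continuousOn_derivWithin (uniqueDiffOn_Icc hab) le_rfl
    have hui' := hu'.integrableOn_Icc (μ := volume)
    have n₁ : 0 ≤ norm1 a b (fun t => u t - f t) := integral_nonneg fun _ => abs_nonneg _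
    have n₂ : 0 ≤ norm1 a b (fun t => derivWithin u (Set.Icc a b) t - g t) :=
      integral_nonneg fun _ => abs_nonneg _
    have pt : ∀ t ∈ Set.Icc a b, |H t - u a| ≤ |u t - f t| +
        norm1 a b (fun t => derivWithin u (Set.Icc a b) t - g t) := by
      intro t ht
      have hsub : Set.Icc a t ⊆ Set.Icc a b := Set.Icc_subset_Icc_right ht.2
      have e1 : ∫ s in a..t, derivWithin u (Set.Icc a b) s = u t - u a := by
        apply intervalIntegral.integral_eq_sub_of_hasDerivAt_of_le ht.1 (hu.continuousOn.mono hsub)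
        · intro s hs
          have hs' : s ∈ Set.Ioo a b := ⟨hs.1, hs.2.trans_le ht.2⟩
          exact ((hu.differentiableOn one_ne_zero) s
            (Set.Ioo_subset_Icc_self hs')).hasDerivWithinAt.hasDerivAt (Icc_mem_nhds hs'.1 hs'.2)
        · exact (intervalIntegrable_iff_integrableOn_Icc_of_le ht.1).2 (hui'.mono_set hsub)
      have e2 : |∫ s in a..t, (derivWithin u (Set.Icc a b) s - g s)| ≤
          norm1 a b (fun t => derivWithin u (Set.Icc a b) t - g t) := by
        refine (intervalIntegral.abs_integral_le_integral_abs ht.1).trans ?_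
        rw [intervalIntegral.integral_of_le ht.1, ← integral_Icc_eq_integral_Ioc]
        exact setIntegral_mono_set (hui'.sub h.integrableOn).abs
          (Filter.Eventually.of_forall fun _ => abs_nonneg _) hsub.eventuallyLE
      rw [intervalIntegral.integral_sub
        ((intervalIntegrable_iff_integrableOn_Icc_of_le ht.1).2 (hui'.mono_set hsub))
        ((intervalIntegrable_iff_integrableOn_Icc_of_le ht.1).2 (h.integrableOn.mono_set hsub)),
        e1] at e2
      have e3 : H t - u a = -(u t - f t) + ((u t - u a) - ∫ s in a..t, g s) := by
        simp only [hH]; ring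
      rw [e3]
      exact (abs_add_le _ _).trans (by rw [abs_neg]; gcongr)
    have hui : IntegrableOn (fun t => |u t - f t|) (Set.Icc a b) :=
      ((hu.continuousOn.sub h.continuousOn).integrableOn_Icc).abs
    calc ∫ t in Set.Icc a b, |H t - u a|
        ≤ ∫ t in Set.Icc a b, (|u t - f t| +
          norm1 a b (fun t => derivWithin u (Set.Icc a b) t - g t)) :=
          setIntegral_mono_on (hHci _) (hui.add (hci _)) measurableSet_Icc pt
      _ = norm1 a b (fun t => u t - f t) +
          (b - a) * norm1 a b (fun t => derivWithin u (Set.Icc a b) t - g t) := by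
          rw [integral_add hui (hci _)]
          simp [norm1, hab.le]
      _ ≤ _ := by nlinarith
  -- The constants c above vary with ε. Replacing them by the mean of H costs at most a factor 2,
  -- since (b - a)|m - c| ≤ ∫|H - c|; so H = m almost everywhere, and everywhere by continuity.
  set m : ℝ := (∫ t in Set.Icc a b, H t) / (b - a) with hm
  have hba : 0 < b - a := sub_pos.2 hab
  have hzero : ∫ t in Set.Icc a b, |H t - m| = 0 := by
    refine le_antisymm (le_of_forall_pos_le_add fun ε hε => ?_)
      (integral_nonneg fun _ => abs_nonneg _)
    obtain ⟨c, hc⟩ := approx (ε / (2 * (1 + (b - a)))) (by positivity)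
    have e1 : (1 + (b - a)) * (ε / (2 * (1 + (b - a)))) = ε / 2 := by field_simp
    rw [e1] at hc
    have e2 : (b - a) * |m - c| ≤ ε / 2 := by
      have : ∫ t in Set.Icc a b, (H t - c) = (b - a) * (m - c) := by
        rw [integral_sub hHi (hci c), hm]
        simp [hab.le]
        field_simp
      rw [← abs_of_pos hba, ← abs_mul, ← this]
      exact (abs_integral_le_integral_abs).trans hc
    calc ∫ t in Set.Icc a b, |H t - m|
        ≤ ∫ t in Set.Icc a b, (|H t - c| + |m - c|) := by
          refine setIntegral_mono_on (hHci _) ((hHci _).add (hci _))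
            measurableSet_Icc fun t _ => ?_
          rw [abs_sub_comm m c]
          exact abs_sub_le _ _ _
      _ = (∫ t in Set.Icc a b, |H t - c|) + (b - a) * |m - c| := by
          rw [integral_add (hHci _) (hci _)]
          simp [hab.le]
      _ ≤ 0 + ε := by linarith
  rw [setIntegral_eq_zero_iff_of_nonneg_ae (Filter.Eventually.of_forall fun _ => abs_nonneg _)
    (hHci _)] at hzero
  have hEq : Set.EqOn H (fun _ => m) (Set.Icc a b) := by
    refine Measure.eqOn_Icc_of_ae_eq volume hab.ne ?_ hHc continuousOn_const
    filter_upwards [hzero] with t ht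
    exact sub_eq_zero.1 (abs_eq_zero.1 ht)
  have e1 := hEq ht
  have e2 := hEq (Set.left_mem_Icc.2 hab.le)
  simp only [hH, intervalIntegral.integral_same, sub_zero] at e1 e2
  linarith

/-- Integration by parts with the factor b - s. As g is only integrable, the version for absolutely
continuous functions is needed. -/
theorem integral_primitive {a b : ℝ} {g : ℝ → ℝ} (hab : a ≤ b)
    (hg : IntegrableOn g (Set.Icc a b)) :
    ∫ t in a..b, ∫ s in a..t, g s = ∫ s in a..b, (b - s) * g s := by
  have hgi : IntervalIntegrable g volume a b :=
    (intervalIntegrable_iff_integrableOn_Icc_of_le hab).2 hg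
  have hac := hgi.absolutelyContinuousOnInterval_intervalIntegral (c := a) (by simp)
  have hid : AbsolutelyContinuousOnInterval (fun s : ℝ => b - s) a b := by
    apply LipschitzOnWith.absolutelyContinuousOnInterval (K := 1)
    apply LipschitzWith.lipschitzOnWith
    exact LipschitzWith.of_dist_le_mul fun x y => by
      rw [NNReal.coe_one, one_mul, Real.dist_eq, Real.dist_eq, abs_sub_comm x y]
      apply le_of_eq; congr 1; ring
  have e := hid.integral_mul_deriv_eq_deriv_mul hac
  have e1 : ∫ s in a..b, (b - s) * deriv (fun t => ∫ s in a..t, g s) s =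
      ∫ s in a..b, (b - s) * g s := by
    apply intervalIntegral.integral_congr_ae
    filter_upwards [hgi.ae_hasDerivAt_integral] with t ht hm
    rw [(ht (Set.uIoc_subset_uIcc hm) a (by simp)).deriv]
  rw [e1] at e
  rw [e]
  simp

/-- If j and j' are the least integers with qj + c ≥ a and qj' + c > t, the count is j' - j, and
each endpoint overshoots by at most one step q in the same direction, so the two errors do not add
up. The constant 1 is what makes the error in the progression sums exactly ‖f‖_∞ + ‖f'‖₁. -/
theorem abs_card_modEq_sub_le {a t : ℝ} (ha : 0 ≤ a) (hat : a ≤ t) (q c : ℕ) (hq : 0 < q) :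
    |(((Finset.Icc ⌈a⌉₊ ⌊t⌋₊).filter (fun n => n ≡ c [MOD q])).card : ℝ) - (t - a) / q| ≤ 1 := by
  have hI : Finset.Icc ⌈a⌉₊ ⌊t⌋₊ = Finset.Ico ⌈a⌉₊ (⌊t⌋₊ + 1) := by
    ext; simp
  have key := Nat.Ico_filter_modEq_card ⌈a⌉₊ (⌊t⌋₊ + 1) hq c
  rw [← hI] at key
  set N := ((Finset.Icc ⌈a⌉₊ ⌊t⌋₊).filter (fun n => n ≡ c [MOD q])).card
  have hqQ : (0 : ℚ) < q := by exact_mod_cast hq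
  have hqR : (0 : ℝ) < q := by exact_mod_cast hq
  set j : ℤ := ⌈((⌈a⌉₊ : ℕ) - (c : ℚ)) / (q : ℚ)⌉ with hj
  set j' : ℤ := ⌈(((⌊t⌋₊ + 1 : ℕ) : ℚ) - c) / q⌉ with hj'
  have ht0 : 0 ≤ t := ha.trans hat
  have j1 : (⌈a⌉₊ : ℤ) ≤ q * j + c := by
    have := Int.le_ceil (((⌈a⌉₊ : ℕ) - (c : ℚ)) / (q : ℚ))
    rw [← hj, div_le_iff₀ hqQ] at this
    have : ((⌈a⌉₊ : ℕ) : ℚ) ≤ q * j + c := by linarith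
    exact_mod_cast this
  have j2 : (q : ℤ) * (j - 1) + c < ⌈a⌉₊ := by
    have := Int.ceil_lt_add_one (((⌈a⌉₊ : ℕ) - (c : ℚ)) / (q : ℚ))
    rw [← hj, ← sub_lt_iff_lt_add, lt_div_iff₀ hqQ] at this
    have : (q : ℚ) * (j - 1) + c < (⌈a⌉₊ : ℕ) := by linarith
    exact_mod_cast this
  have j3 : (⌊t⌋₊ : ℤ) + 1 ≤ q * j' + c := by
    have := Int.le_ceil ((((⌊t⌋₊ + 1 : ℕ) : ℚ) - c) / q)
    rw [← hj', div_le_iff₀ hqQ] at this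
    have : ((⌊t⌋₊ + 1 : ℕ) : ℚ) ≤ q * j' + c := by linarith
    exact_mod_cast this
  have j4 : (q : ℤ) * (j' - 1) + c < ⌊t⌋₊ + 1 := by
    have := Int.ceil_lt_add_one ((((⌊t⌋₊ + 1 : ℕ) : ℚ) - c) / q)
    rw [← hj', ← sub_lt_iff_lt_add, lt_div_iff₀ hqQ] at this
    have : (q : ℚ) * (j' - 1) + c < (⌊t⌋₊ + 1 : ℕ) := by linarith
    exact_mod_cast this
  have r1 : a ≤ q * j + c := (Nat.le_ceil a).trans (by exact_mod_cast j1)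
  have r2 : (q : ℝ) * (j - 1) + c < a := by
    by_contra! hcon
    have : a ≤ (((q : ℤ) * (j - 1) + c : ℤ) : ℝ) := by push_cast; exact hcon
    have h2 := Int.ceil_le.2 this
    rw [← Int.natCast_ceil_eq_ceil ha] at h2
    exact absurd h2 (not_le.2 (by exact_mod_cast j2))
  have r3 : t < q * j' + c := (Nat.lt_floor_add_one t).trans_le (by exact_mod_cast j3)
  have r4 : (q : ℝ) * (j' - 1) + c ≤ t := by
    have : (q : ℤ) * (j' - 1) + c ≤ ⌊t⌋₊ := by omega
    exact le_trans (by exact_mod_cast this) (Nat.floor_le ht0)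
  have key' : (N : ℝ) = max ((j' : ℝ) - j) 0 := by
    rw [← Int.cast_natCast, key]; push_cast; rfl
  rw [key', abs_le]
  have d0 : 0 ≤ (t - a) / q := div_nonneg (sub_nonneg.2 hat) hqR.le
  have d1 : (t - a) / q - 1 ≤ (j' : ℝ) - j := by
    rw [sub_le_iff_le_add, div_le_iff₀ hqR]; nlinarith
  have d2 : (j' : ℝ) - j ≤ (t - a) / q + 1 := by
    rw [← sub_le_iff_le_add, le_div_iff₀ hqR]; nlinarith
  constructor
  · linarith [le_max_left ((j' : ℝ) - j) 0]
  · rw [sub_le_iff_le_add, max_le_iff]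
    constructor <;> linarith

theorem abs_le_normSup {a b : ℝ} {f : ℝ → ℝ} (hf : ContinuousOn f (Set.Icc a b)) {t : ℝ}
    (ht : t ∈ Set.Icc a b) : |f t| ≤ normSup a b f :=
  le_csSup (isCompact_Icc.image_of_continuousOn hf.abs).bddAbove ⟨t, ht, rfl⟩

/-- Sums of a `W^{1,1}` function over an arithmetic progression are close to the integral. -/
theorem HasW11Deriv.abs_sum_modEq_sub_le {a b : ℝ} {f g : ℝ → ℝ} (ha : 0 ≤ a) (hab : a < b)
    (h : HasW11Deriv a b f g) (q c : ℕ) (hq : 0 < q) :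
    |(∑ n ∈ Finset.Icc ⌈a⌉₊ ⌊b⌋₊ with n ≡ c [MOD q], f n) - (∫ t in Set.Icc a b, f t) / q| ≤
      normSup a b f + norm1 a b g := by
  set S := (Finset.Icc ⌈a⌉₊ ⌊b⌋₊).filter (fun n => n ≡ c [MOD q]) with hS
  have memS : ∀ n ∈ S, (n : ℝ) ∈ Set.Icc a b := by
    intro n hn
    rw [hS, Finset.mem_filter, Finset.mem_Icc] at hn
    exact ⟨(Nat.ceil_le.1 hn.1.1), (Nat.le_floor_iff (ha.trans hab.le)).1 hn.1.2⟩
  have hfb := h.eq_add_integral hab (Set.right_mem_Icc.2 hab.le)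
  have ind : ∀ n ∈ S, IntegrableOn (fun t => if (n : ℝ) ≤ t then g t else 0) (Set.Icc a b) := by
    intro n _
    exact h.integrableOn.indicator (measurableSet_Ici (a := (n : ℝ)))
  have pt : ∀ n ∈ S, f n = f b - ∫ t in Set.Icc a b, if (n : ℝ) ≤ t then g t else 0 := by
    intro n hn
    have hn' := memS n hn
    have e1 : ∫ t in Set.Icc a b, (if (n : ℝ) ≤ t then g t else 0) = ∫ t in (n : ℝ)..b, g t := by
      have : (fun t => if (n : ℝ) ≤ t then g t else 0) = (Set.Ici (n : ℝ)).indicator g := by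
        ext t; simp [Set.indicator]
      rw [this, setIntegral_indicator measurableSet_Ici,
        intervalIntegral.integral_of_le hn'.2, ← integral_Icc_eq_integral_Ioc]
      congr 2
      ext t
      simp only [Set.mem_inter_iff, Set.mem_Icc, Set.mem_Ici]
      exact ⟨fun h => ⟨h.2, h.1.2⟩, fun h => ⟨⟨hn'.1.trans h.1, h.2⟩, h.1⟩⟩
    have hsub1 : Set.Icc a (n : ℝ) ⊆ Set.Icc a b := Set.Icc_subset_Icc_right hn'.2
    have hsub2 : Set.Icc (n : ℝ) b ⊆ Set.Icc a b := Set.Icc_subset_Icc_left hn'.1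
    rw [e1, h.eq_add_integral hab hn', hfb, ← intervalIntegral.integral_add_adjacent_intervals
      ((intervalIntegrable_iff_integrableOn_Icc_of_le hn'.1).2 (h.integrableOn.mono_set hsub1))
      ((intervalIntegrable_iff_integrableOn_Icc_of_le hn'.2).2 (h.integrableOn.mono_set hsub2))]
    ring
  -- Summing f(n) = f(b) - ∫_n^b g over n and exchanging sum and integral puts the counting function
  -- M(t) in front of g.
  set M : ℝ → ℝ := fun t => ∑ n ∈ S, if (n : ℝ) ≤ t then (1 : ℝ) else 0 with hM
  have hMcard : ∀ t ∈ Set.Icc a b,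
      M t = ((Finset.Icc ⌈a⌉₊ ⌊t⌋₊).filter (fun n => n ≡ c [MOD q])).card := by
    intro t ht
    rw [hM]
    simp only
    rw [← Finset.sum_filter, Finset.sum_const, nsmul_eq_mul, mul_one]
    congr 2
    ext n
    simp only [hS, Finset.mem_filter, Finset.mem_Icc,
      Nat.le_floor_iff (ha.trans ht.1), Nat.le_floor_iff (ha.trans hab.le)]
    exact ⟨fun h => ⟨⟨h.1.1.1, h.2⟩, h.1.2⟩, fun h => ⟨⟨⟨h.1.1, h.1.2.trans ht.2⟩, h.2⟩, h.1.2⟩⟩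
  have hMdisc : ∀ t ∈ Set.Icc a b, |M t - (t - a) / q| ≤ 1 := fun t ht => by
    rw [hMcard t ht]; exact abs_card_modEq_sub_le ha ht.1 q c hq
  have hMint : IntegrableOn (fun t => M t * g t) (Set.Icc a b) := by
    have : (fun t => M t * g t) = fun t => ∑ n ∈ S, if (n : ℝ) ≤ t then g t else 0 := by
      ext t; simp only [hM, Finset.sum_mul, ite_mul, one_mul, zero_mul]
    rw [this]
    exact integrable_finsetSum _ ind
  have hlin : IntegrableOn (fun t => (t - a) * g t) (Set.Icc a b) :=
    h.integrableOn.continuousOn_mul (by fun_prop) isCompact_Icc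
  have sumeq : ∑ n ∈ S, f n = S.card * f b - ∫ t in Set.Icc a b, M t * g t := by
    rw [Finset.sum_congr rfl pt, Finset.sum_sub_distrib, Finset.sum_const, nsmul_eq_mul,
      ← integral_finsetSum _ ind]
    congr 2
    ext t
    simp only [hM, Finset.sum_mul, ite_mul, one_mul, zero_mul]
  -- The same identity for the integral, with t - a in the role of M(t); after division by q, only
  -- the discrepancies of the count remain.
  have inteq : ∫ t in Set.Icc a b, f t = (b - a) * f b - ∫ t in Set.Icc a b, (t - a) * g t := by
    have e1 : ∫ t in Set.Icc a b, f t = ∫ t in Set.Icc a b, (f a + ∫ s in a..t, g s) :=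
      setIntegral_congr_fun measurableSet_Icc fun t ht => h.eq_add_integral hab ht
    have e2 : ∫ t in Set.Icc a b, ∫ s in a..t, g s = ∫ t in Set.Icc a b, (b - t) * g t := by
      rw [integral_Icc_eq_integral_Ioc, integral_Icc_eq_integral_Ioc,
        ← intervalIntegral.integral_of_le hab.le, ← intervalIntegral.integral_of_le hab.le]
      exact integral_primitive hab.le h.integrableOn
    have e3 : ∫ t in Set.Icc a b, (b - t) * g t =
        (b - a) * (∫ t in Set.Icc a b, g t) - ∫ t in Set.Icc a b, (t - a) * g t := by
      rw [← integral_const_mul, ← integral_sub (h.integrableOn.const_mul _) hlin]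
      congr 1; ext t; ring
    rw [e1, integral_add continuousOn_const.integrableOn_Icc
      ((continuousOn_primitive_Icc hab.le h.integrableOn).integrableOn_Icc (μ := volume)),
      e2, e3, hfb, intervalIntegral.integral_of_le hab.le, ← integral_Icc_eq_integral_Ioc]
    simp [hab.le]
    ring
  have hcomb : ∑ n ∈ S, f n - (∫ t in Set.Icc a b, f t) / q =
      (S.card - (b - a) / q) * f b - ∫ t in Set.Icc a b, (M t - (t - a) / q) * g t := by
    have : ∫ t in Set.Icc a b, (M t - (t - a) / q) * g t =
        (∫ t in Set.Icc a b, M t * g t) - (∫ t in Set.Icc a b, (t - a) * g t) / q := by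
      rw [← integral_div, ← integral_sub hMint (hlin.div_const _)]
      congr 1; ext t; ring
    rw [sumeq, inteq, this]
    ring
  rw [hcomb]
  refine (abs_sub _ _).trans (add_le_add ?_ ?_)
  · rw [abs_mul]
    have h1 : |(S.card : ℝ) - (b - a) / q| ≤ 1 := abs_card_modEq_sub_le ha hab.le q c hq
    have h2 := abs_le_normSup h.continuousOn (Set.right_mem_Icc.2 hab.le)
    nlinarith [abs_nonneg (f b), abs_nonneg ((S.card : ℝ) - (b - a) / q)]
  · rw [← Real.norm_eq_abs, norm1]
    refine norm_integral_le_of_norm_le h.integrableOn.abs ?_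
    refine (ae_restrict_mem measurableSet_Icc).mono fun t ht => ?_
    rw [norm_mul, Real.norm_eq_abs, Real.norm_eq_abs]
    exact mul_le_of_le_one_left (abs_nonneg _) (hMdisc t ht)

/-! ### Upper bound sieves for equidistributed weights -/

/-- Weights `w` on `J` whose sum over every residue class mod `q` is `F / q` up to an error `E`. -/
structure IsEquidistributed (J : Finset ℕ) (w : ℕ → ℝ) (F E : ℝ) : Prop where
  nonneg : ∀ n ∈ J, 0 ≤ w n
  le : ∀ n ∈ J, w n ≤ E
  abs_sub_le : ∀ q c : ℕ, 0 < q → |(∑ n ∈ J with n ≡ c [MOD q], w n) - F / q| ≤ E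
  nonneg_error : 0 ≤ E

/-- The sum of the weights over the primes `p ≡ l mod k` in `J`. -/
def weightedPrimeSum (J : Finset ℕ) (w : ℕ → ℝ) (k l : ℕ) : ℝ :=
  ∑ p ∈ J with p.Prime ∧ p ≡ l [MOD k], w p

namespace IsEquidistributed

variable {J : Finset ℕ} {w : ℕ → ℝ} {F E : ℝ}

/-- Exchange the sums: each divisor d contributes its coefficient times the weight of the class l
mod k intersected with the multiples of d. That is a single class mod kd by the Chinese remainder
theorem, so it carries F/(kd) up to E. -/
theorem sum_divisor_weights_le (h : IsEquidistributed J w F E) {k : ℕ} (l : ℕ) (hk : 0 < k)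
    {ι : Type*} (s : Finset ι) (d : ι → ℕ) (c : ι → ℝ) (hd : ∀ i ∈ s, 0 < d i)
    (hdk : ∀ i ∈ s, (d i).Coprime k) :
    ∑ n ∈ J with n ≡ l [MOD k], w n * ∑ i ∈ s with d i ∣ n, c i ≤
      F / k * (∑ i ∈ s, c i / d i) + E * ∑ i ∈ s, |c i| := by
  have swap : ∑ n ∈ J with n ≡ l [MOD k], w n * ∑ i ∈ s with d i ∣ n, c i =
      ∑ i ∈ s, c i * ∑ n ∈ J with n ≡ l [MOD k] ∧ d i ∣ n, w n := by
    simp only [Finset.sum_filter, Finset.mul_sum, ite_and]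
    rw [Finset.sum_congr rfl (g := fun n => ∑ i ∈ s, if n ≡ l [MOD k] then
      (if d i ∣ n then c i * w n else 0) else 0)]
    · rw [Finset.sum_comm]
      refine Finset.sum_congr rfl fun i _ => Finset.sum_congr rfl fun n _ => ?_
      split_ifs <;> simp
    · intro n _
      split_ifs
      · refine Finset.sum_congr rfl fun i _ => ?_
        split_ifs <;> ring
      · simp
  rw [swap, Finset.mul_sum, Finset.mul_sum, ← Finset.sum_add_distrib]
  refine Finset.sum_le_sum fun i hi => ?_
  obtain ⟨r, hr1, hr2⟩ := Nat.chineseRemainder (hdk i hi).symm l 0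
  have e : ∑ n ∈ J with n ≡ l [MOD k] ∧ d i ∣ n, w n =
      ∑ n ∈ J with n ≡ r [MOD k * d i], w n := by
    congr 1
    refine Finset.filter_congr fun n _ => ?_
    rw [← Nat.modEq_and_modEq_iff_modEq_mul (hdk i hi).symm, ← Nat.modEq_zero_iff_dvd]
    exact ⟨fun h => ⟨h.1.trans hr1.symm, h.2.trans hr2.symm⟩,
      fun h => ⟨h.1.trans hr1, h.2.trans hr2⟩⟩
  rw [e]
  have hb := h.abs_sub_le (k * d i) r (Nat.mul_pos hk (hd i hi))
  set T := ∑ n ∈ J with n ≡ r [MOD k * d i], w n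
  have e2 : c i * T = F / k * (c i / d i) + c i * (T - F / ((k * d i : ℕ) : ℝ)) := by
    have h1 : (k : ℝ) ≠ 0 := by exact_mod_cast hk.ne'
    have h2 : (d i : ℝ) ≠ 0 := by exact_mod_cast (hd i hi).ne'
    push_cast
    field_simp
    ring
  rw [e2]
  refine add_le_add le_rfl ?_
  calc c i * (T - F / ((k * d i : ℕ) : ℝ)) ≤ |c i * (T - F / ((k * d i : ℕ) : ℝ))| := le_abs_self _
    _ = |c i| * |T - F / ((k * d i : ℕ) : ℝ)| := abs_mul _ _
    _ ≤ |c i| * E := by gcongr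
    _ = E * |c i| := mul_comm _ _

/-- An upper bound sieve: the divisor sum of the coefficients `c` is nonnegative, and at least one
at all primes outside of `B`. -/
theorem weightedPrimeSum_le_of_sieve (h : IsEquidistributed J w F E) {k : ℕ} (l : ℕ) (hk : 0 < k)
    {ι : Type*} (s : Finset ι) (d : ι → ℕ) (c : ι → ℝ) (hd : ∀ i ∈ s, 0 < d i)
    (hdk : ∀ i ∈ s, (d i).Coprime k) (B : Finset ℕ)
    (h0 : ∀ n, 0 ≤ ∑ i ∈ s with d i ∣ n, c i)
    (h1 : ∀ p : ℕ, p.Prime → p ∉ B → 1 ≤ ∑ i ∈ s with d i ∣ p, c i) :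
    weightedPrimeSum J w k l ≤ F / k * (∑ i ∈ s, c i / d i) + E * (∑ i ∈ s, |c i| + B.card) := by
  have key := h.sum_divisor_weights_le l hk s d c hd hdk
  have hE := h.nonneg_error
  -- Primes in the exceptional set B, where the sieve may vanish, are paid for one by one through w
  -- ≤ E.
  have step : weightedPrimeSum J w k l ≤
      (∑ n ∈ J with n ≡ l [MOD k], w n * ∑ i ∈ s with d i ∣ n, c i) + ∑ n ∈ B, E := by
    rw [weightedPrimeSum, ← Finset.sum_filter_add_sum_filter_not _ (fun p => p ∉ B)]
    refine add_le_add ?_ ?_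
    · calc _ ≤ ∑ p ∈ (J.filter fun p => p.Prime ∧ p ≡ l [MOD k]) with p ∉ B,
            w p * ∑ i ∈ s with d i ∣ p, c i := by
            refine Finset.sum_le_sum fun p hp => ?_
            simp only [Finset.mem_filter] at hp
            exact le_mul_of_one_le_right (h.nonneg p hp.1.1) (h1 p hp.1.2.1 hp.2)
        _ ≤ _ := by
            refine Finset.sum_le_sum_of_subset_of_nonneg ?_ ?_
            · intro p hp
              simp only [Finset.mem_filter] at hp ⊢
              exact ⟨hp.1.1, hp.1.2.2⟩
            · intro p hp _
              exact mul_nonneg (h.nonneg p (Finset.mem_filter.1 hp).1) (h0 p)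
    · calc _ ≤ ∑ p ∈ (J.filter fun p => p.Prime ∧ p ≡ l [MOD k]) with ¬ p ∉ B, E := by
            refine Finset.sum_le_sum fun p hp => ?_
            simp only [Finset.mem_filter] at hp
            exact h.le p hp.1.1
        _ ≤ _ := by
            refine Finset.sum_le_sum_of_subset_of_nonneg ?_ fun _ _ _ => hE
            intro p hp
            simp only [Finset.mem_filter, not_not] at hp
            exact hp.2
  rw [Finset.sum_const, nsmul_eq_mul] at step
  linarith

/-- The sieve of Eratosthenes–Legendre. -/
theorem weightedPrimeSum_le_legendre (h : IsEquidistributed J w F E) {k : ℕ} (l : ℕ) (hk : 0 < k)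
    (Q : Finset ℕ) (hQ : ∀ q ∈ Q, q.Prime) (hQk : ∀ q ∈ Q, q.Coprime k) :
    weightedPrimeSum J w k l ≤
      F / k * (∏ q ∈ Q, (1 - 1 / (q : ℝ))) + E * (2 ^ Q.card + Q.card) := by
  have hsub : ∀ T ∈ Q.powerset, ∀ q ∈ T, q.Prime := fun T hT q hq =>
    hQ q (Finset.mem_powerset.1 hT hq)
  have hsum : ∀ n : ℕ, ∑ T ∈ Q.powerset with (∏ q ∈ T, q) ∣ n, (-1 : ℝ) ^ T.card =
      if Q.filter (· ∣ n) = ∅ then 1 else 0 := by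
    intro n
    have e : Q.powerset.filter (fun T => (∏ q ∈ T, q) ∣ n) = (Q.filter (· ∣ n)).powerset := by
      ext T
      simp only [Finset.mem_filter, Finset.mem_powerset, Finset.subset_iff]
      constructor
      · rintro ⟨h1, h2⟩ q hq
        exact ⟨h1 hq, (Finset.dvd_prod_of_mem _ hq).trans h2⟩
      · intro h1
        exact ⟨fun q hq => (h1 hq).1, Finset.prod_primes_dvd n
          (fun q hq => (hQ q (h1 hq).1).prime) fun q hq => (h1 hq).2⟩
    rw [e]
    have := Finset.sum_powerset_neg_one_pow_card (x := Q.filter (· ∣ n))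
    exact_mod_cast this
  have key := h.weightedPrimeSum_le_of_sieve l hk Q.powerset (fun T => ∏ q ∈ T, q)
    (fun T => (-1) ^ T.card)
    (fun T hT => Finset.prod_pos fun q hq => (hsub T hT q hq).pos)
    (fun T hT => Nat.Coprime.prod_left fun q hq => hQk q (Finset.mem_powerset.1 hT hq)) Q
    (fun n => by rw [hsum]; split_ifs <;> norm_num)
    (fun p hp hpQ => by
      rw [hsum, if_pos]
      rw [Finset.filter_eq_empty_iff]
      intro q hq hqp
      rw [Nat.prime_dvd_prime_iff_eq (hQ q hq) hp] at hqp
      exact hpQ (hqp ▸ hq))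
  have e1 : ∑ T ∈ Q.powerset, |(-1 : ℝ) ^ T.card| = 2 ^ Q.card := by
    simp [abs_pow]
  have e2 : ∑ T ∈ Q.powerset, (-1 : ℝ) ^ T.card / ((∏ q ∈ T, q : ℕ) : ℝ) =
      ∏ q ∈ Q, (1 - 1 / (q : ℝ)) := by
    rw [Finset.prod_sub]
    refine Finset.sum_congr rfl fun T _ => ?_
    simp [div_eq_mul_inv, Finset.prod_inv_distrib]
  rw [e1, e2] at key
  exact key

end IsEquidistributed

/-! ### Selberg's coefficients and the quadratic form -/

/-- The squarefree numbers up to `N` that are coprime to `k`. -/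
def sieveSupport (N k : ℕ) : Finset ℕ :=
  (Finset.Icc 1 N).filter fun n => Squarefree n ∧ n.Coprime k

theorem mem_sieveSupport {N k n : ℕ} :
    n ∈ sieveSupport N k ↔ (1 ≤ n ∧ n ≤ N) ∧ Squarefree n ∧ n.Coprime k := by
  rw [sieveSupport, Finset.mem_filter, Finset.mem_Icc]

theorem mem_sieveSupport_of_dvd {N k n d : ℕ} (hn : n ∈ sieveSupport N k) (hd : d ∣ n) :
    d ∈ sieveSupport N k := by
  rw [mem_sieveSupport] at hn ⊢
  exact ⟨⟨Nat.pos_of_dvd_of_pos hd hn.1.1, (Nat.le_of_dvd hn.1.1 hd).trans hn.1.2⟩,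
    hn.2.1.squarefree_of_dvd hd, hn.2.2.coprime_dvd_left hd⟩

/-- The sum of `1 / φ(n)` in the main term of Selberg's sieve. -/
noncomputable def selbergSum (N k : ℕ) : ℝ := ∑ n ∈ sieveSupport N k, ((Nat.totient n : ℝ))⁻¹

/-- The sum of `σ(n) / φ(n)` that bounds the coefficients of Selberg's sieve. -/
noncomputable def selbergErrorSum (N k : ℕ) : ℝ :=
  ∑ n ∈ sieveSupport N k, (∑ d ∈ n.divisors, (d : ℝ)) * ((Nat.totient n : ℝ))⁻¹

theorem one_mem_sieveSupport {N k : ℕ} (hN : 1 ≤ N) : 1 ∈ sieveSupport N k :=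
  mem_sieveSupport.2 ⟨⟨le_rfl, hN⟩, squarefree_one, Nat.coprime_one_left k⟩

theorem selbergSum_pos {N k : ℕ} (hN : 1 ≤ N) : 0 < selbergSum N k :=
  Finset.sum_pos' (fun _ _ => by positivity) ⟨1, one_mem_sieveSupport hN, by simp⟩

/-- The optimal coefficients of Selberg's sieve. -/
noncomputable def selbergWeight (N k d : ℕ) : ℝ :=
  ArithmeticFunction.moebius d * d * (selbergSum N k)⁻¹ *
    ∑ n ∈ sieveSupport N k with d ∣ n, ((Nat.totient n : ℝ))⁻¹

theorem selbergWeight_one {N k : ℕ} (hN : 1 ≤ N) : selbergWeight N k 1 = 1 := by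
  have := (selbergSum_pos (k := k) hN).ne'
  rw [selbergSum] at this
  simp [selbergWeight, selbergSum, this]

theorem sum_moebius_divisors (n : ℕ) :
    ∑ d ∈ n.divisors, ArithmeticFunction.moebius d = if n = 1 then 1 else 0 := by
  rw [← ArithmeticFunction.coe_mul_zeta_apply, ArithmeticFunction.moebius_mul_coe_zeta,
    ArithmeticFunction.one_apply]

theorem sum_moebius_divisors_filter_dvd {n : ℕ} (hn : Squarefree n) (r : ℕ) :
    ∑ d ∈ n.divisors with r ∣ d, ArithmeticFunction.moebius d =
      if n = r then ArithmeticFunction.moebius r else 0 := by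
  by_cases hr : r ∣ n
  · obtain ⟨m, rfl⟩ := hr
    have hr0 : 0 < r := Nat.pos_of_ne_zero (left_ne_zero_of_mul hn.ne_zero)
    have hm0 : m ≠ 0 := right_ne_zero_of_mul hn.ne_zero
    have hcop : r.Coprime m := Nat.coprime_of_squarefree_mul hn
    have e : (r * m).divisors.filter (r ∣ ·) = m.divisors.image (r * ·) := by
      ext d
      simp only [Finset.mem_filter, Nat.mem_divisors, Finset.mem_image]
      constructor
      · rintro ⟨⟨h1, _⟩, e, rfl⟩
        exact ⟨e, ⟨Nat.dvd_of_mul_dvd_mul_left hr0 h1, hm0⟩, rfl⟩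
      · rintro ⟨e, ⟨h1, _⟩, rfl⟩
        exact ⟨⟨Nat.mul_dvd_mul_left r h1, hn.ne_zero⟩, dvd_mul_right r e⟩
    rw [e, Finset.sum_image fun x _ y _ hxy => Nat.eq_of_mul_eq_mul_left hr0 hxy]
    have e2 : ∑ x ∈ m.divisors, ArithmeticFunction.moebius (r * x) =
        ArithmeticFunction.moebius r * ∑ x ∈ m.divisors, ArithmeticFunction.moebius x := by
      rw [Finset.mul_sum]
      refine Finset.sum_congr rfl fun x hx => ?_
      exact ArithmeticFunction.isMultiplicative_moebius.map_mul_of_coprime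
        (hcop.coprime_dvd_right (Nat.dvd_of_mem_divisors hx))
    rw [e2, sum_moebius_divisors]
    by_cases hm : m = 1
    · simp [hm]
    · rw [if_neg hm, if_neg, mul_zero]
      intro h
      exact hm (Nat.eq_of_mul_eq_mul_left hr0 (by rw [h, mul_one]))
  · rw [if_neg (fun h : n = r => hr (by rw [h])), Finset.filter_false_of_mem, Finset.sum_empty]
    intro d hd hrd
    exact hr (hrd.trans (Nat.dvd_of_mem_divisors hd))

/-- Möbius inversion over multiples: these are the variables in which the quadratic form is
diagonal. After the exchange of sums, the inner Möbius sum over r ∣ d ∣ n keeps only n = r. -/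
theorem sum_selbergWeight_div {N k r : ℕ} (hr : r ∈ sieveSupport N k) :
    ∑ d ∈ sieveSupport N k with r ∣ d, selbergWeight N k d / d =
      (selbergSum N k)⁻¹ * ArithmeticFunction.moebius r * ((Nat.totient r : ℝ))⁻¹ := by
  have e1 : ∑ d ∈ sieveSupport N k with r ∣ d, selbergWeight N k d / d =
      (selbergSum N k)⁻¹ * ∑ n ∈ sieveSupport N k, ((Nat.totient n : ℝ))⁻¹ *
        ((∑ d ∈ n.divisors with r ∣ d, ArithmeticFunction.moebius d : ℤ) : ℝ) := by
    have e2 : ∀ d ∈ (sieveSupport N k).filter (r ∣ ·), selbergWeight N k d / d =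
        (selbergSum N k)⁻¹ * ∑ n ∈ sieveSupport N k,
          if d ∣ n then ((Nat.totient n : ℝ))⁻¹ * ArithmeticFunction.moebius d else 0 := by
      intro d hd
      have hd0 : (d : ℝ) ≠ 0 := by
        have := (mem_sieveSupport.1 (Finset.mem_filter.1 hd).1).1.1
        positivity
      rw [selbergWeight, Finset.sum_filter]
      have : ∀ n, (if d ∣ n then ((Nat.totient n : ℝ))⁻¹ * (ArithmeticFunction.moebius d : ℝ) else 0)
          = (if d ∣ n then ((Nat.totient n : ℝ))⁻¹ else 0) * ArithmeticFunction.moebius d := by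
        intro n; split_ifs <;> simp
      simp only [this]
      rw [← Finset.sum_mul]
      field_simp
    rw [Finset.sum_congr rfl e2, ← Finset.mul_sum, Finset.sum_comm]
    congr 1
    refine Finset.sum_congr rfl fun n hn => ?_
    rw [← Finset.sum_filter, ← Finset.mul_sum]
    push_cast
    congr 1
    refine Finset.sum_congr ?_ fun _ _ => rfl
    ext d
    simp only [Finset.mem_filter, Nat.mem_divisors]
    have := (mem_sieveSupport.1 hn).1.1
    exact ⟨fun h => ⟨⟨h.2, by omega⟩, h.1.2⟩,
      fun h => ⟨⟨mem_sieveSupport_of_dvd hn h.1.1, h.2⟩, h.1.1⟩⟩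
  rw [e1, mul_assoc]
  congr 1
  rw [Finset.sum_congr rfl (g := fun n => if n = r then
    (ArithmeticFunction.moebius r : ℝ) * ((Nat.totient r : ℝ))⁻¹ else 0)]
  · rw [Finset.sum_ite_eq' (sieveSupport N k) r, if_pos hr]
  · intro n hn
    rw [sum_moebius_divisors_filter_dvd (mem_sieveSupport.1 hn).2.1]
    split_ifs with hnr
    · subst hnr; ring
    · simp

/-- The value of Selberg's quadratic form at its minimum. -/
theorem sum_selbergWeight_mul_div_lcm {N k : ℕ} (hN : 1 ≤ N) :
    ∑ i ∈ sieveSupport N k ×ˢ sieveSupport N k,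
      selbergWeight N k i.1 * selbergWeight N k i.2 / (Nat.lcm i.1 i.2 : ℕ) =
      (selbergSum N k)⁻¹ := by
  set A := sieveSupport N k with hA
  have e1 : ∀ i ∈ A ×ˢ A,
      selbergWeight N k i.1 * selbergWeight N k i.2 / (Nat.lcm i.1 i.2 : ℕ) =
      ∑ r ∈ A, (Nat.totient r : ℝ) * ((if r ∣ i.1 then selbergWeight N k i.1 / i.1 else 0) *
        (if r ∣ i.2 then selbergWeight N k i.2 / i.2 else 0)) := by
    intro i hi
    rw [Finset.mem_product] at hi
    have h1 := (mem_sieveSupport.1 hi.1).1.1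
    have h2 := (mem_sieveSupport.1 hi.2).1.1
    have hg0 : Nat.gcd i.1 i.2 ≠ 0 := (Nat.gcd_pos_of_pos_left _ h1).ne'
    -- Selberg's diagonalisation: 1/lcm = gcd/(d₁d₂) and gcd = ∑ φ(r) over common divisors r, so the
    -- form becomes ∑ φ(r)·y_r² with y_r = ∑_{r ∣ d} λ_d/d.
    have hgcd : ((Nat.gcd i.1 i.2 : ℕ) : ℝ) =
        ∑ r ∈ A, if r ∣ i.1 ∧ r ∣ i.2 then (Nat.totient r : ℝ) else 0 := by
      rw [← Finset.sum_filter]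
      conv_lhs => rw [← Nat.sum_totient (Nat.gcd i.1 i.2)]
      push_cast
      refine Finset.sum_congr ?_ fun _ _ => rfl
      ext r
      rw [Nat.mem_divisors, Finset.mem_filter, Nat.dvd_gcd_iff]
      exact ⟨fun h => ⟨mem_sieveSupport_of_dvd hi.1 h.1.1, h.1⟩, fun h => ⟨h.2, hg0⟩⟩
    have hl : ((Nat.gcd i.1 i.2 : ℕ) : ℝ) * (Nat.lcm i.1 i.2 : ℕ) = i.1 * i.2 := by
      exact_mod_cast Nat.gcd_mul_lcm i.1 i.2
    have hl0 : ((Nat.lcm i.1 i.2 : ℕ) : ℝ) ≠ 0 := by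
      have := Nat.lcm_pos h1 h2
      positivity
    have h1' : (i.1 : ℝ) ≠ 0 := by positivity
    have h2' : (i.2 : ℝ) ≠ 0 := by positivity
    have e3 : selbergWeight N k i.1 * selbergWeight N k i.2 / (Nat.lcm i.1 i.2 : ℕ) =
        ((Nat.gcd i.1 i.2 : ℕ) : ℝ) *
          (selbergWeight N k i.1 / i.1 * (selbergWeight N k i.2 / i.2)) := by
      field_simp
      linear_combination -(selbergWeight N k i.1 * selbergWeight N k i.2) * hl
    rw [e3, hgcd, Finset.sum_mul]
    refine Finset.sum_congr rfl fun r _ => ?_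
    by_cases a1 : r ∣ i.1 <;> by_cases a2 : r ∣ i.2 <;> simp [a1, a2]
  have e2 : ∀ r ∈ A, ∑ i ∈ A ×ˢ A, (Nat.totient r : ℝ) *
      ((if r ∣ i.1 then selbergWeight N k i.1 / i.1 else 0) *
        (if r ∣ i.2 then selbergWeight N k i.2 / i.2 else 0)) =
      ((selbergSum N k)⁻¹) ^ 2 * ((Nat.totient r : ℝ))⁻¹ := by
    intro r hr
    have hφ : (Nat.totient r : ℝ) ≠ 0 := by
      have := Nat.totient_pos.2 (mem_sieveSupport.1 hr).1.1
      positivity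
    have hμ : (ArithmeticFunction.moebius r : ℝ) ^ 2 = 1 := by
      exact_mod_cast ArithmeticFunction.moebius_sq_eq_one_of_squarefree (mem_sieveSupport.1 hr).2.1
    rw [← Finset.mul_sum, Finset.sum_product]
    simp only
    rw [← Finset.sum_mul_sum, ← Finset.sum_filter, sum_selbergWeight_div hr]
    field_simp
    linear_combination (selbergSum N k)⁻¹ ^ 2 * hμ
  rw [Finset.sum_congr rfl e1, Finset.sum_comm, Finset.sum_congr rfl e2, ← Finset.mul_sum]
  have hS := (selbergSum_pos (k := k) hN).ne'
  change _ * selbergSum N k = _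
  field_simp

/-- Bound |μ(d)| by 1 and sum over d first: the factors d with d ∣ n add up to σ(n). -/
theorem sum_abs_selbergWeight_le (N k : ℕ) :
    ∑ d ∈ sieveSupport N k, |selbergWeight N k d| ≤ selbergErrorSum N k / selbergSum N k := by
  have hS : 0 ≤ selbergSum N k := Finset.sum_nonneg fun _ _ => by positivity
  have e1 : ∀ d ∈ sieveSupport N k, |selbergWeight N k d| ≤
      (selbergSum N k)⁻¹ * ∑ n ∈ sieveSupport N k,
        if d ∣ n then (d : ℝ) * ((Nat.totient n : ℝ))⁻¹ else 0 := by
    intro d _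
    have hT : 0 ≤ ∑ n ∈ sieveSupport N k with d ∣ n, ((Nat.totient n : ℝ))⁻¹ :=
      Finset.sum_nonneg fun _ _ => by positivity
    have hμ : |(ArithmeticFunction.moebius d : ℝ)| ≤ 1 := by
      exact_mod_cast ArithmeticFunction.abs_moebius_le_one
    rw [← Finset.sum_filter, ← Finset.mul_sum, selbergWeight, abs_mul, abs_mul, abs_mul,
      abs_of_nonneg hT, abs_of_nonneg (inv_nonneg.2 hS), Nat.abs_cast]
    calc _ ≤ 1 * (d : ℝ) * (selbergSum N k)⁻¹ *
          ∑ n ∈ sieveSupport N k with d ∣ n, ((Nat.totient n : ℝ))⁻¹ := by gcongr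
      _ = _ := by ring
  refine (Finset.sum_le_sum e1).trans (le_of_eq ?_)
  rw [← Finset.mul_sum, Finset.sum_comm, div_eq_inv_mul, selbergErrorSum]
  congr 1
  refine Finset.sum_congr rfl fun n hn => ?_
  rw [← Finset.sum_filter, Finset.sum_mul]
  refine Finset.sum_congr ?_ fun _ _ => rfl
  ext d
  have := (mem_sieveSupport.1 hn).1.1
  simp only [Finset.mem_filter, Nat.mem_divisors]
  exact ⟨fun h => ⟨h.2, by omega⟩, fun h => ⟨mem_sieveSupport_of_dvd hn h.1, h.1⟩⟩

/-- Selberg's sieve for primes in a residue class. -/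
theorem IsEquidistributed.weightedPrimeSum_le_selberg {J : Finset ℕ} {w : ℕ → ℝ} {F E : ℝ}
    (h : IsEquidistributed J w F E) {k : ℕ} (l : ℕ) (hk : 0 < k) {N : ℕ} (hN : 1 ≤ N) :
    weightedPrimeSum J w k l ≤ F / (k * selbergSum N k) +
      E * ((selbergErrorSum N k / selbergSum N k) ^ 2 + N) := by
  set A := sieveSupport N k with hA
  have hsq : ∀ n : ℕ, ∑ i ∈ A ×ˢ A with Nat.lcm i.1 i.2 ∣ n,
      selbergWeight N k i.1 * selbergWeight N k i.2 =
      (∑ d ∈ A with d ∣ n, selbergWeight N k d) ^ 2 := by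
    intro n
    rw [sq, Finset.sum_mul_sum, ← Finset.sum_product', ← Finset.filter_product]
    simp only [Nat.lcm_dvd_iff]
  have key := h.weightedPrimeSum_le_of_sieve l hk (A ×ˢ A) (fun i => Nat.lcm i.1 i.2)
    (fun i => selbergWeight N k i.1 * selbergWeight N k i.2)
    (fun i hi => by
      rw [Finset.mem_product] at hi
      exact Nat.lcm_pos (mem_sieveSupport.1 hi.1).1.1 (mem_sieveSupport.1 hi.2).1.1)
    (fun i hi => by
      rw [Finset.mem_product] at hi
      exact Nat.Coprime.coprime_dvd_left (Nat.lcm_dvd_mul _ _)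
        (Nat.Coprime.mul_left (mem_sieveSupport.1 hi.1).2.2 (mem_sieveSupport.1 hi.2).2.2))
    (Finset.Icc 1 N)
    (fun n => by rw [hsq]; positivity)
    (fun p hp hpN => by
      rw [hsq]
      have : A.filter (· ∣ p) = {1} := by
        ext d
        rw [Finset.mem_filter, Finset.mem_singleton, Nat.dvd_prime hp]
        constructor
        · rintro ⟨h1, h2 | h2⟩
          · exact h2
          · subst h2
            exact absurd (Finset.mem_Icc.2 (mem_sieveSupport.1 h1).1) hpN
        · rintro rfl
          exact ⟨one_mem_sieveSupport hN, Or.inl rfl⟩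
      rw [this, Finset.sum_singleton, selbergWeight_one hN]
      norm_num)
  rw [sum_selbergWeight_mul_div_lcm hN, Nat.card_Icc, Nat.add_sub_cancel] at key
  refine key.trans (add_le_add (le_of_eq ?_) ?_)
  · rw [← div_div, div_eq_mul_inv (F / k)]
  · refine mul_le_mul_of_nonneg_left ?_ h.nonneg_error
    gcongr
    have : ∑ i ∈ A ×ˢ A, |selbergWeight N k i.1 * selbergWeight N k i.2| =
        (∑ d ∈ A, |selbergWeight N k d|) ^ 2 := by
      rw [sq, Finset.sum_mul_sum, ← Finset.sum_product']
      simp only [abs_mul]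
    rw [this]
    exact pow_le_pow_left₀ (Finset.sum_nonneg fun _ _ => abs_nonneg _)
      (sum_abs_selbergWeight_le N k) 2

/-! ### Lower bound for the main term -/

theorem totient_eq_mul_prod_real (n : ℕ) :
    (Nat.totient n : ℝ) = n * ∏ p ∈ n.primeFactors, (1 - 1 / (p : ℝ)) := by
  have := congrArg (Rat.cast : ℚ → ℝ) (Nat.totient_eq_mul_prod_factors n)
  push_cast at this
  simpa [one_div] using this

/-- Finite sums of reciprocals of integers composed of primes from `s`. -/
theorem sum_inv_le_prod_of_factoredNumbers (s T : Finset ℕ)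
    (hT : ∀ m ∈ T, m ∈ Nat.factoredNumbers s) :
    ∑ m ∈ T, (m : ℝ)⁻¹ ≤ ∏ p ∈ s with p.Prime, (1 - (p : ℝ)⁻¹)⁻¹ := by
  let f : ℕ →* ℝ :=
    { toFun := fun n => (n : ℝ)⁻¹
      map_one' := by simp
      map_mul' := fun a b => by push_cast; rw [mul_inv] }
  have hf : ∀ {p : ℕ}, p.Prime → ‖f p‖ < 1 := by
    intro p hp
    have : (1 : ℝ) < p := by exact_mod_cast hp.one_lt
    change ‖(p : ℝ)⁻¹‖ < 1
    rw [norm_inv, Real.norm_natCast]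
    exact inv_lt_one_of_one_lt₀ this
  have hs := (EulerProduct.summable_and_hasSum_factoredNumbers_prod_filter_prime_geometric hf s).2
  have h2 := (hasSum_subtype_iff_indicator (f := fun m : ℕ => (m : ℝ)⁻¹)
    (s := Nat.factoredNumbers s)).1 hs
  have h3 := sum_le_hasSum T (fun m _ => Set.indicator_nonneg (fun _ _ => by positivity) m) h2
  refine le_trans (le_of_eq (Finset.sum_congr rfl fun m hm => ?_)) h3
  rw [Set.indicator_of_mem (hT m hm)]

/-- The lower bound for the main term of Selberg's sieve. -/
theorem log_le_mul_selbergSum (N : ℕ) {k : ℕ} (hk : 0 < k) :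
    Real.log (N + 1) ≤ k / (Nat.totient k : ℝ) * selbergSum N k := by
  have hharm : Real.log (N + 1) ≤ ∑ m ∈ Finset.Icc 1 N, (m : ℝ)⁻¹ := by
    have := log_add_one_le_harmonic N
    rw [harmonic_eq_sum_Icc] at this
    push_cast at this
    exact this
  -- Group the harmonic sum by the part n of the radical of m that is coprime to k. The cofactor m/n
  -- only has primes dividing kn, so the Euler product bounds the group by (1/n)·(k/φ(k))·(n/φ(n)).
  set ν : ℕ → ℕ := fun m => ∏ p ∈ m.primeFactors with ¬ p ∣ k, p with hν
  have hνpf : ∀ m, (ν m).primeFactors = m.primeFactors.filter fun p => ¬ p ∣ k := fun m =>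
    Nat.primeFactors_prod fun p hp => Nat.prime_of_mem_primeFactors (Finset.mem_filter.1 hp).1
  have hνdvd : ∀ m, ν m ∣ m := fun m =>
    (Finset.prod_dvd_prod_of_subset _ _ _ (Finset.filter_subset _ _)).trans
      (Nat.prod_primeFactors_dvd m)
  have hνmem : ∀ m ∈ Finset.Icc 1 N, ν m ∈ sieveSupport N k := by
    intro m hm
    rw [Finset.mem_Icc] at hm
    have hpr : ∀ p ∈ m.primeFactors.filter (fun p => ¬ p ∣ k), p.Prime := fun p hp =>
      Nat.prime_of_mem_primeFactors (Finset.mem_filter.1 hp).1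
    refine mem_sieveSupport.2 ⟨⟨Finset.prod_pos fun p hp => (hpr p hp).pos,
      (Nat.le_of_dvd hm.1 (hνdvd m)).trans hm.2⟩, ?_, ?_⟩
    · refine Finset.squarefree_prod_of_pairwise_isCoprime ?_ fun p hp => (hpr p hp).squarefree
      intro p hp q hq hpq
      exact Nat.coprime_iff_isRelPrime.1 ((Nat.coprime_primes (hpr p hp) (hpr q hq)).2 hpq)
    · refine Nat.Coprime.prod_left fun p hp => ?_
      exact (Nat.Prime.coprime_iff_not_dvd (hpr p hp)).2 (Finset.mem_filter.1 hp).2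
  refine hharm.trans ?_
  rw [← Finset.sum_fiberwise_of_maps_to hνmem, selbergSum, Finset.mul_sum]
  refine Finset.sum_le_sum fun n hn => ?_
  obtain ⟨⟨hn1, -⟩, hnsq, hnk⟩ := mem_sieveSupport.1 hn
  have hn0 : (n : ℝ) ≠ 0 := by positivity
  set T := ((Finset.Icc 1 N).filter fun m => ν m = n).image (· / n) with hT
  have hdvd : ∀ m ∈ (Finset.Icc 1 N).filter (fun m => ν m = n), n ∣ m := by
    intro m hm
    rw [← (Finset.mem_filter.1 hm).2]
    exact hνdvd m
  have e1 : ∑ m ∈ Finset.Icc 1 N with ν m = n, (m : ℝ)⁻¹ = (n : ℝ)⁻¹ * ∑ m ∈ T, (m : ℝ)⁻¹ := by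
    rw [hT, Finset.sum_image, Finset.mul_sum]
    · refine Finset.sum_congr rfl fun m hm => ?_
      rw [Nat.cast_div (hdvd m hm) hn0]
      field_simp
    · intro x hx y hy hxy
      rw [← Nat.div_mul_cancel (hdvd x hx), ← Nat.div_mul_cancel (hdvd y hy)]
      exact congrArg (· * n) hxy
  have hfac : ∀ m ∈ T, m ∈ Nat.factoredNumbers (k * n).primeFactors := by
    intro m hm
    obtain ⟨m', hm', rfl⟩ := Finset.mem_image.1 hm
    have hd := hdvd m' hm'
    rw [Finset.mem_filter, Finset.mem_Icc] at hm'
    rw [Nat.mem_factoredNumbers_iff_primeFactors_subset]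
    have hne : m' / n ≠ 0 := (Nat.div_pos (Nat.le_of_dvd hm'.1.1 hd) hn1).ne'
    refine ⟨hne, fun p hp => ?_⟩
    have hpp := Nat.prime_of_mem_primeFactors hp
    have hpm : p ∣ m' := (Nat.dvd_of_mem_primeFactors hp).trans (Nat.div_dvd_of_dvd hd)
    rw [Nat.mem_primeFactors]
    refine ⟨hpp, ?_, by positivity⟩
    by_cases hpk : p ∣ k
    · exact hpk.mul_right n
    · have : p ∈ (ν m').primeFactors := by
        rw [hνpf, Finset.mem_filter, Nat.mem_primeFactors]
        exact ⟨⟨hpp, hpm, by omega⟩, hpk⟩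
      rw [hm'.2] at this
      exact (Nat.dvd_of_mem_primeFactors this).mul_left k
  have hb := sum_inv_le_prod_of_factoredNumbers (k * n).primeFactors T hfac
  have e2 : ∏ p ∈ (k * n).primeFactors with p.Prime, (1 - (p : ℝ)⁻¹)⁻¹ =
      (k / (Nat.totient k : ℝ)) * (n / (Nat.totient n : ℝ)) := by
    rw [Finset.filter_true_of_mem fun p hp => Nat.prime_of_mem_primeFactors hp]
    have h1 := totient_eq_mul_prod_real (k * n)
    rw [Nat.totient_mul hnk.symm] at h1
    simp only [one_div] at h1
    push_cast at h1
    have hk0 : (k : ℝ) ≠ 0 := by positivity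
    have hφ1 : (Nat.totient k : ℝ) ≠ 0 := by have := Nat.totient_pos.2 hk; positivity
    have hφ2 : (Nat.totient n : ℝ) ≠ 0 := by have := Nat.totient_pos.2 hn1; positivity
    rw [Finset.prod_inv_distrib]
    set D := ∏ p ∈ (k * n).primeFactors, (1 - (p : ℝ)⁻¹)
    have hD : D ≠ 0 := by
      intro h0
      rw [h0, mul_zero] at h1
      exact mul_ne_zero hφ1 hφ2 h1
    field_simp
    linarith
  rw [e1]
  calc (n : ℝ)⁻¹ * ∑ m ∈ T, (m : ℝ)⁻¹
      ≤ (n : ℝ)⁻¹ * ((k / (Nat.totient k : ℝ)) * (n / (Nat.totient n : ℝ))) := by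
        rw [← e2]; gcongr
    _ = k / (Nat.totient k : ℝ) * ((Nat.totient n : ℝ))⁻¹ := by field_simp

/-! ### Size of Selberg's coefficients -/

/-- The quotient `σ(n) / φ(n)`. -/
noncomputable def sigmaDivTotient (n : ℕ) : ℝ :=
  (∑ d ∈ n.divisors, (d : ℝ)) * ((Nat.totient n : ℝ))⁻¹

theorem sigmaDivTotient_nonneg (n : ℕ) : 0 ≤ sigmaDivTotient n := by
  unfold sigmaDivTotient; positivity

/-- The new factor (p + 1)/(p - 1) is at most 2 for p ≥ 3 but equals 3 at p = 2. This is why the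
modulus is made even. -/
theorem sigmaDivTotient_mul_prime_le {m p : ℕ} (hp : p.Prime) (hp2 : p ≠ 2)
    (hmp : m.Coprime p) : sigmaDivTotient (m * p) ≤ 2 * sigmaDivTotient m := by
  have h3 : 3 ≤ p := by have := hp.two_le; omega
  have h1 : (∑ d ∈ (m * p).divisors, (d : ℝ)) = (∑ d ∈ m.divisors, (d : ℝ)) * (p + 1) := by
    have := Nat.Coprime.sum_divisors_mul hmp
    rw [hp.sum_divisors] at this
    have h := congrArg (Nat.cast : ℕ → ℝ) this
    push_cast at h
    rw [h]
  have h2 : ((m * p).totient : ℝ) = (m.totient : ℝ) * ((p : ℝ) - 1) := by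
    rw [Nat.totient_mul hmp, Nat.totient_prime hp]
    push_cast [Nat.cast_sub hp.one_le]
    ring
  unfold sigmaDivTotient
  rw [h1, h2, mul_inv]
  have h3' : (3 : ℝ) ≤ p := by exact_mod_cast h3
  have h4 : ((p : ℝ) + 1) * ((p : ℝ) - 1)⁻¹ ≤ 2 := by
    rw [← div_eq_mul_inv, div_le_iff₀ (by linarith)]; linarith
  have h5 : 0 ≤ (∑ d ∈ m.divisors, (d : ℝ)) * (m.totient : ℝ)⁻¹ := by positivity
  calc _ = (∑ d ∈ m.divisors, (d : ℝ)) * (m.totient : ℝ)⁻¹ *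
        (((p : ℝ) + 1) * ((p : ℝ) - 1)⁻¹) := by ring
    _ ≤ (∑ d ∈ m.divisors, (d : ℝ)) * (m.totient : ℝ)⁻¹ * 2 := by gcongr
    _ = _ := by ring

theorem log_eq_sum_primeFactors {n : ℕ} (hn : Squarefree n) :
    Real.log n = ∑ p ∈ n.primeFactors, Real.log p := by
  conv_lhs => rw [← Nat.prod_primeFactors_of_squarefree hn]
  push_cast
  rw [Real.log_prod]
  intro p hp
  exact_mod_cast (Nat.prime_of_mem_primeFactors hp).ne_zero

theorem ne_two_of_dvd_mem_sieveSupport {N k n p : ℕ} (hk : 2 ∣ k) (hn : n ∈ sieveSupport N k)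
    (hpn : p ∣ n) : p ≠ 2 := by
  rintro rfl
  have := Nat.dvd_gcd hpn hk
  rw [(mem_sieveSupport.1 hn).2.2] at this
  omega

/-- Write log n = ∑_{p ∣ n} log p and n = mp, so that σ/φ at n is at most twice its value at m. For
fixed m the primes p ≤ N/m contribute θ(N/m) ≤ log 4 · N/m. -/
theorem sum_sigmaDivTotient_mul_log_le (N : ℕ) {k : ℕ} (hk : 2 ∣ k) :
    ∑ n ∈ sieveSupport N k, sigmaDivTotient n * Real.log n ≤
      2 * Real.log 4 * N * ∑ n ∈ sieveSupport N k, sigmaDivTotient n / n := by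
  set A := sieveSupport N k with hA
  set P := (Finset.Ioc 0 N).filter Nat.Prime with hP
  have e1 : ∀ n ∈ A, sigmaDivTotient n * Real.log n ≤
      ∑ p ∈ P, if p ∣ n then 2 * sigmaDivTotient (n / p) * Real.log p else 0 := by
    intro n hn
    obtain ⟨⟨hn1, hnN⟩, hnsq, hnk⟩ := mem_sieveSupport.1 hn
    have hPn : P.filter (· ∣ n) = n.primeFactors := by
      ext p
      simp only [hP, Finset.mem_filter, Finset.mem_Ioc, Nat.mem_primeFactors]
      constructor
      · rintro ⟨⟨_, h1⟩, h2⟩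
        exact ⟨h1, h2, by omega⟩
      · rintro ⟨h1, h2, _⟩
        exact ⟨⟨⟨h1.pos, (Nat.le_of_dvd hn1 h2).trans hnN⟩, h1⟩, h2⟩
    rw [log_eq_sum_primeFactors hnsq, Finset.mul_sum, ← Finset.sum_filter, hPn]
    refine Finset.sum_le_sum fun p hp => ?_
    obtain ⟨hpp, hpn, -⟩ := Nat.mem_primeFactors.1 hp
    obtain ⟨m, rfl⟩ := hpn
    rw [Nat.mul_div_cancel_left m hpp.pos]
    have hcop : m.Coprime p := (Nat.coprime_of_squarefree_mul hnsq).symm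
    have := sigmaDivTotient_mul_prime_le hpp
      (ne_two_of_dvd_mem_sieveSupport hk hn (dvd_mul_right p m)) hcop
    rw [mul_comm m p] at this
    exact mul_le_mul_of_nonneg_right this (Real.log_natCast_nonneg p)
  have e2 : ∀ p ∈ P, ∑ n ∈ A, (if p ∣ n then 2 * sigmaDivTotient (n / p) * Real.log p else 0) ≤
      ∑ m ∈ A, if m * p ≤ N then 2 * sigmaDivTotient m * Real.log p else 0 := by
    intro p hp
    have hpp : p.Prime := (Finset.mem_filter.1 hp).2
    rw [← Finset.sum_filter, ← Finset.sum_filter]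
    have hinj : Set.InjOn (· / p) ((A.filter (p ∣ ·) : Finset ℕ) : Set ℕ) := by
      intro x hx y hy hxy
      have hx' := (Finset.mem_filter.1 (Finset.mem_coe.1 hx)).2
      have hy' := (Finset.mem_filter.1 (Finset.mem_coe.1 hy)).2
      rw [← Nat.div_mul_cancel hx', ← Nat.div_mul_cancel hy']
      exact congrArg (· * p) hxy
    rw [← Finset.sum_image (f := fun m => 2 * sigmaDivTotient m * Real.log p) hinj]
    refine Finset.sum_le_sum_of_subset_of_nonneg ?_ ?_
    · intro m hm
      obtain ⟨n, hn, rfl⟩ := Finset.mem_image.1 hm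
      rw [Finset.mem_filter] at hn ⊢
      refine ⟨mem_sieveSupport_of_dvd hn.1 (Nat.div_dvd_of_dvd hn.2), ?_⟩
      rw [Nat.div_mul_cancel hn.2]
      exact (mem_sieveSupport.1 hn.1).1.2
    · intro m _ _
      have := sigmaDivTotient_nonneg m
      have := Real.log_natCast_nonneg p
      positivity
  have e3 : ∀ m ∈ A, ∑ p ∈ P, (if m * p ≤ N then 2 * sigmaDivTotient m * Real.log p else 0) ≤
      2 * Real.log 4 * N * (sigmaDivTotient m / m) := by
    intro m hm
    have hm1 := (mem_sieveSupport.1 hm).1.1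
    have hm0 : (0 : ℝ) < m := by exact_mod_cast hm1
    have hθ : ∑ p ∈ P with m * p ≤ N, Real.log p ≤ Chebyshev.theta ((N : ℝ) / m) := by
      unfold Chebyshev.theta
      refine Finset.sum_le_sum_of_subset_of_nonneg ?_ fun p _ _ => Real.log_natCast_nonneg p
      intro p hp
      simp only [hP, Finset.mem_filter, Finset.mem_Ioc] at hp ⊢
      refine ⟨⟨hp.1.1.1, ?_⟩, hp.1.2⟩
      rw [Nat.le_floor_iff (by positivity), le_div_iff₀ hm0]
      exact_mod_cast (mul_comm m p ▸ hp.2)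
    have hch := Chebyshev.theta_le_log4_mul_x (x := (N : ℝ) / m) (by positivity)
    rw [← Finset.sum_filter, ← Finset.mul_sum]
    have h0 := sigmaDivTotient_nonneg m
    calc 2 * sigmaDivTotient m * ∑ p ∈ P with m * p ≤ N, Real.log p
        ≤ 2 * sigmaDivTotient m * (Real.log 4 * ((N : ℝ) / m)) := by
          gcongr; exact hθ.trans hch
      _ = _ := by ring
  calc _ ≤ ∑ n ∈ A, ∑ p ∈ P, if p ∣ n then 2 * sigmaDivTotient (n / p) * Real.log p else 0 :=
        Finset.sum_le_sum e1
    _ = ∑ p ∈ P, ∑ n ∈ A, if p ∣ n then 2 * sigmaDivTotient (n / p) * Real.log p else 0 :=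
        Finset.sum_comm
    _ ≤ ∑ p ∈ P, ∑ m ∈ A, if m * p ≤ N then 2 * sigmaDivTotient m * Real.log p else 0 :=
        Finset.sum_le_sum e2
    _ = ∑ m ∈ A, ∑ p ∈ P, if m * p ≤ N then 2 * sigmaDivTotient m * Real.log p else 0 :=
        Finset.sum_comm
    _ ≤ ∑ m ∈ A, 2 * Real.log 4 * N * (sigmaDivTotient m / m) := Finset.sum_le_sum e3
    _ = _ := by rw [Finset.mul_sum]

theorem log_le_div_exp_one {u : ℝ} (hu : 0 < u) : Real.log u ≤ u / Real.exp 1 := by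
  have := Real.add_one_le_exp (Real.log u - 1)
  rw [Real.exp_sub, Real.exp_log hu] at this
  linarith

/-- Split log z = log n + log(z/n): the first part is the Chebyshev estimate, the second uses log u
≤ u/e with u = z/n. -/
theorem selbergErrorSum_mul_log_le {N k : ℕ} (hk : 2 ∣ k) {z : ℝ} (hz : (N : ℝ) ≤ z) :
    selbergErrorSum N k * Real.log z ≤
      (2 * Real.log 4 + 1 / Real.exp 1) * z * ∑ n ∈ sieveSupport N k, sigmaDivTotient n / n := by
  have h1 := sum_sigmaDivTotient_mul_log_le N hk
  have hT : 0 ≤ ∑ n ∈ sieveSupport N k, sigmaDivTotient n / n :=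
    Finset.sum_nonneg fun n _ => div_nonneg (sigmaDivTotient_nonneg n) (Nat.cast_nonneg n)
  have e : selbergErrorSum N k * Real.log z = ∑ n ∈ sieveSupport N k, sigmaDivTotient n * Real.log n
      + ∑ n ∈ sieveSupport N k, sigmaDivTotient n * (Real.log z - Real.log n) := by
    rw [← Finset.sum_add_distrib, selbergErrorSum, Finset.sum_mul]
    refine Finset.sum_congr rfl fun n _ => ?_
    unfold sigmaDivTotient
    ring
  have h2 : ∑ n ∈ sieveSupport N k, sigmaDivTotient n * (Real.log z - Real.log n) ≤
      1 / Real.exp 1 * z * ∑ n ∈ sieveSupport N k, sigmaDivTotient n / n := by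
    rw [Finset.mul_sum]
    refine Finset.sum_le_sum fun n hn => ?_
    obtain ⟨⟨hn1, hnN⟩, -⟩ := mem_sieveSupport.1 hn
    have hn0 : (0 : ℝ) < n := by exact_mod_cast hn1
    have hz0 : 0 < z := (hn0.trans_le (by exact_mod_cast hnN)).trans_le hz
    rw [← Real.log_div hz0.ne' hn0.ne']
    calc _ ≤ sigmaDivTotient n * (z / n / Real.exp 1) :=
          mul_le_mul_of_nonneg_left (log_le_div_exp_one (by positivity)) (sigmaDivTotient_nonneg n)
      _ = _ := by ring
  have h3 : 2 * Real.log 4 * N * ∑ n ∈ sieveSupport N k, sigmaDivTotient n / n ≤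
      2 * Real.log 4 * z * ∑ n ∈ sieveSupport N k, sigmaDivTotient n / n := by
    have : 0 ≤ Real.log 4 := Real.log_nonneg (by norm_num)
    gcongr
  rw [e]
  linarith

/-- Each term is a product of 1/(p(p-1)) over the odd primes p ∣ d. Enlarging to all sets of
integers from 3 to N gives a product of 1 + x ≤ e^x, whose exponent telescopes to less than 1/2. -/
theorem sum_inv_mul_totient_le (N : ℕ) {k : ℕ} (hk : 2 ∣ k) :
    ∑ d ∈ sieveSupport N k, ((d : ℝ) * Nat.totient d)⁻¹ ≤ Real.exp (1 / 2) := by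
  set x : ℕ → ℝ := fun n => ((n : ℝ) * ((n : ℝ) - 1))⁻¹ with hx
  have hx0 : ∀ n : ℕ, 0 ≤ x n := by
    intro n
    rcases Nat.eq_zero_or_pos n with rfl | h
    · simp [hx]
    · have : (1 : ℝ) ≤ n := by exact_mod_cast h
      exact inv_nonneg.2 (mul_nonneg (by linarith) (by linarith))
  have e1 : ∀ d ∈ sieveSupport N k, ((d : ℝ) * Nat.totient d)⁻¹ = ∏ p ∈ d.primeFactors, x p := by
    intro d hd
    have hsq := (mem_sieveSupport.1 hd).2.1
    have h1 : (d : ℝ) = ∏ p ∈ d.primeFactors, (p : ℝ) := by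
      conv_lhs => rw [← Nat.prod_primeFactors_of_squarefree hsq]
      push_cast; rfl
    rw [totient_eq_mul_prod_real]
    conv_lhs => rw [h1]
    rw [← Finset.prod_mul_distrib, ← Finset.prod_mul_distrib, ← Finset.prod_inv_distrib]
    refine Finset.prod_congr rfl fun p hp => ?_
    have : (p : ℝ) ≠ 0 := by exact_mod_cast (Nat.prime_of_mem_primeFactors hp).ne_zero
    simp only [hx]
    congr 2
    field_simp
  have hinj : Set.InjOn Nat.primeFactors ((sieveSupport N k : Finset ℕ) : Set ℕ) := by
    intro a ha b hb hab
    rw [← Nat.prod_primeFactors_of_squarefree (mem_sieveSupport.1 (Finset.mem_coe.1 ha)).2.1, hab,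
      Nat.prod_primeFactors_of_squarefree (mem_sieveSupport.1 (Finset.mem_coe.1 hb)).2.1]
  have hsub : (sieveSupport N k).image Nat.primeFactors ⊆ (Finset.Icc 3 N).powerset := by
    intro T hT
    obtain ⟨d, hd, rfl⟩ := Finset.mem_image.1 hT
    rw [Finset.mem_powerset]
    intro p hp
    obtain ⟨hpp, hpd, -⟩ := Nat.mem_primeFactors.1 hp
    have h2 := ne_two_of_dvd_mem_sieveSupport hk hd hpd
    have := hpp.two_le
    have := (mem_sieveSupport.1 (mem_sieveSupport_of_dvd hd hpd)).1.2
    rw [Finset.mem_Icc]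
    omega
  have tel : ∀ M : ℕ, ∑ n ∈ Finset.Icc 3 M, x n ≤ 1 / 2 := by
    have aux : ∀ M : ℕ, 2 ≤ M → ∑ n ∈ Finset.Icc 3 M, x n = 1 / 2 - 1 / (M : ℝ) := by
      intro M hM
      induction M, hM using Nat.le_induction with
      | base => simp
      | succ M hM ih =>
        rw [Finset.sum_Icc_succ_top (by omega), ih]
        have : (M : ℝ) ≠ 0 := by positivity
        simp only [hx]
        push_cast
        rw [add_sub_cancel_right]
        field_simp
        ring
    intro M
    rcases Nat.lt_or_ge M 2 with h | h
    · rw [Finset.Icc_eq_empty (by omega)]; norm_num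
    · rw [aux M h]
      have : (0 : ℝ) ≤ 1 / (M : ℝ) := by positivity
      linarith
  calc ∑ d ∈ sieveSupport N k, ((d : ℝ) * Nat.totient d)⁻¹
      = ∑ T ∈ (sieveSupport N k).image Nat.primeFactors, ∏ p ∈ T, x p := by
        rw [Finset.sum_image hinj]
        exact Finset.sum_congr rfl e1
    _ ≤ ∑ T ∈ (Finset.Icc 3 N).powerset, ∏ p ∈ T, x p :=
        Finset.sum_le_sum_of_subset_of_nonneg hsub
          fun T _ _ => Finset.prod_nonneg fun p _ => hx0 p
    _ = ∏ p ∈ Finset.Icc 3 N, (1 + x p) := (Finset.prod_one_add _).symm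
    _ ≤ ∏ p ∈ Finset.Icc 3 N, Real.exp (x p) :=
        Finset.prod_le_prod (fun p _ => by have := hx0 p; positivity) fun p _ => by
          rw [add_comm]; exact Real.add_one_le_exp _
    _ = Real.exp (∑ p ∈ Finset.Icc 3 N, x p) := (Real.exp_sum _ _).symm
    _ ≤ Real.exp (1 / 2) := Real.exp_le_exp.2 (tel N)

/-- Since σ(n)/n = ∑_{d ∣ n} 1/d and φ(n) = φ(d)φ(n/d) for squarefree n, the sum over n splits off a
factor 1/(dφ(d)) and leaves part of S. -/
theorem sum_sigmaDivTotient_div_le (N : ℕ) {k : ℕ} (hk : 2 ∣ k) :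
    ∑ n ∈ sieveSupport N k, sigmaDivTotient n / n ≤ Real.exp (1 / 2) * selbergSum N k := by
  set A := sieveSupport N k with hA
  have hS : 0 ≤ selbergSum N k := Finset.sum_nonneg fun _ _ => by positivity
  have e1 : ∀ n ∈ A, sigmaDivTotient n / n =
      ∑ d ∈ A, if d ∣ n then (d : ℝ)⁻¹ * ((Nat.totient n : ℝ))⁻¹ else 0 := by
    intro n hn
    have hn1 := (mem_sieveSupport.1 hn).1.1
    have hn0 : (n : ℝ) ≠ 0 := by positivity
    have hAn : A.filter (· ∣ n) = n.divisors := by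
      ext d
      simp only [Finset.mem_filter, Nat.mem_divisors]
      exact ⟨fun h => ⟨h.2, by omega⟩, fun h => ⟨mem_sieveSupport_of_dvd hn h.1, h.1⟩⟩
    rw [← Finset.sum_filter, hAn, ← Finset.sum_mul, sigmaDivTotient,
      ← Nat.sum_div_divisors n (fun d => (d : ℝ)), mul_div_right_comm, Finset.sum_div]
    congr 1
    refine Finset.sum_congr rfl fun d hd => ?_
    have hd0 : (d : ℝ) ≠ 0 := by
      have := Nat.pos_of_mem_divisors hd
      positivity
    rw [Nat.cast_div (Nat.dvd_of_mem_divisors hd) hd0]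
    field_simp
  have e2 : ∀ d ∈ A, ∑ n ∈ A, (if d ∣ n then (d : ℝ)⁻¹ * ((Nat.totient n : ℝ))⁻¹ else 0) ≤
      ((d : ℝ) * Nat.totient d)⁻¹ * selbergSum N k := by
    intro d hd
    have hd1 := (mem_sieveSupport.1 hd).1.1
    rw [← Finset.sum_filter]
    have hinj : Set.InjOn (· / d) ((A.filter (d ∣ ·) : Finset ℕ) : Set ℕ) := by
      intro x hx y hy hxy
      have hx' := (Finset.mem_filter.1 (Finset.mem_coe.1 hx)).2
      have hy' := (Finset.mem_filter.1 (Finset.mem_coe.1 hy)).2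
      rw [← Nat.div_mul_cancel hx', ← Nat.div_mul_cancel hy']
      exact congrArg (· * d) hxy
    have e3 : ∀ n ∈ A.filter (d ∣ ·), (d : ℝ)⁻¹ * ((Nat.totient n : ℝ))⁻¹ =
        ((d : ℝ) * Nat.totient d)⁻¹ * ((Nat.totient (n / d) : ℝ))⁻¹ := by
      intro n hn
      rw [Finset.mem_filter] at hn
      obtain ⟨m, rfl⟩ := hn.2
      have hcop := Nat.coprime_of_squarefree_mul (mem_sieveSupport.1 hn.1).2.1
      rw [Nat.mul_div_cancel_left m hd1, Nat.totient_mul hcop]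
      push_cast
      rw [mul_inv, mul_inv]
      ring
    rw [Finset.sum_congr rfl e3, ← Finset.mul_sum,
      ← Finset.sum_image (f := fun m => ((Nat.totient m : ℝ))⁻¹) hinj]
    refine mul_le_mul_of_nonneg_left ?_ (by positivity)
    refine Finset.sum_le_sum_of_subset_of_nonneg ?_ fun _ _ _ => by positivity
    intro m hm
    obtain ⟨n, hn, rfl⟩ := Finset.mem_image.1 hm
    rw [Finset.mem_filter] at hn
    exact mem_sieveSupport_of_dvd hn.1 (Nat.div_dvd_of_dvd hn.2)
  rw [Finset.sum_congr rfl e1, Finset.sum_comm]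
  refine (Finset.sum_le_sum e2).trans ?_
  rw [← Finset.sum_mul]
  exact mul_le_mul_of_nonneg_right (sum_inv_mul_totient_le N hk) hS

/-- The coefficients of Selberg's sieve have absolute sum `O(z / log z)`, uniformly in `k`. -/
theorem selbergErrorSum_div_selbergSum_le {N k : ℕ} (hN : 1 ≤ N) (hk : 2 ∣ k) {z : ℝ}
    (hz : (N : ℝ) ≤ z) (hz1 : 1 < z) :
    selbergErrorSum N k / selbergSum N k ≤
      (2 * Real.log 4 + 1 / Real.exp 1) * Real.exp (1 / 2) * (z / Real.log z) := by
  have hS := selbergSum_pos (k := k) hN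
  have hlog := Real.log_pos hz1
  have h4 : 0 < Real.log 4 := Real.log_pos (by norm_num)
  rw [div_le_iff₀ hS]
  refine le_of_mul_le_mul_right ?_ hlog
  calc selbergErrorSum N k * Real.log z
      ≤ (2 * Real.log 4 + 1 / Real.exp 1) * z * ∑ n ∈ sieveSupport N k, sigmaDivTotient n / n :=
        selbergErrorSum_mul_log_le hk hz
    _ ≤ (2 * Real.log 4 + 1 / Real.exp 1) * z * (Real.exp (1 / 2) * selbergSum N k) := by
        gcongr
        exact sum_sigmaDivTotient_div_le N hk
    _ = _ := by field_simp

/-! ### Explicit estimates for small and large L -/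

theorem exp_neg_le_pow {n : ℕ} {L : ℝ} (h : (n : ℝ) ≤ L) : Real.exp (-L) ≤ (1 / 2.718) ^ n := by
  have he : (2.718 : ℝ) ≤ Real.exp 1 := by have := Real.exp_one_gt_d9; linarith
  calc Real.exp (-L) ≤ Real.exp (-(n : ℝ)) := Real.exp_le_exp.2 (by linarith)
    _ = (1 / Real.exp 1) ^ n := by
      rw [one_div, ← Real.exp_neg, ← Real.exp_nat_mul]; congr 1; ring
    _ ≤ (1 / 2.718) ^ n := by gcongr

namespace IsEquidistributed

variable {J : Finset ℕ} {w : ℕ → ℝ} {F E : ℝ}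

/-- The sieve of Eratosthenes–Legendre with a set of primes that may divide the modulus. -/
theorem weightedPrimeSum_le_mul_prod (h : IsEquidistributed J w F E) {k : ℕ} (l : ℕ) (hk : 0 < k)
    (hF : 0 ≤ F) {X : ℝ} (hE : E = F / k * X) (P : Finset ℕ) (hP : ∀ p ∈ P, p.Prime) :
    weightedPrimeSum J w k l ≤ F / (Nat.totient k : ℝ) *
      (∏ p ∈ P, (1 - 1 / (p : ℝ)) + (2 ^ P.card + P.card) * X) := by
  have key := h.weightedPrimeSum_le_legendre l hk (P.filter fun p => ¬ p ∣ k)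
    (fun q hq => hP q (Finset.mem_filter.1 hq).1)
    (fun q hq => (Nat.Prime.coprime_iff_not_dvd (hP q (Finset.mem_filter.1 hq).1)).2
      (Finset.mem_filter.1 hq).2)
  have hk0 : (0 : ℝ) < k := by exact_mod_cast hk
  have hφ0 : (0 : ℝ) < Nat.totient k := by exact_mod_cast Nat.totient_pos.2 hk
  have hφk : (Nat.totient k : ℝ) ≤ k := by exact_mod_cast Nat.totient_le k
  have hfac : ∀ p : ℕ, p.Prime → 0 ≤ 1 - 1 / (p : ℝ) ∧ 1 - 1 / (p : ℝ) ≤ 1 := by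
    intro p hp
    have : (1 : ℝ) ≤ p := by exact_mod_cast hp.one_le
    constructor
    · rw [sub_nonneg, div_le_one (by linarith)]; exact this
    · have : 0 ≤ 1 / (p : ℝ) := by positivity
      linarith
  have hcard : (P.filter fun p => ¬ p ∣ k).card ≤ P.card := Finset.card_filter_le _ _
  have hprod : F / k * ∏ p ∈ P with ¬ p ∣ k, (1 - 1 / (p : ℝ)) ≤
      F / (Nat.totient k : ℝ) * ∏ p ∈ P, (1 - 1 / (p : ℝ)) := by
    -- Primes of P dividing k cannot be sieved, but their factors are already present in φ(k)/k; the
    -- bound is therefore uniform in k.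
    have h1 : (Nat.totient k : ℝ) / k ≤ ∏ p ∈ P with p ∣ k, (1 - 1 / (p : ℝ)) := by
      rw [totient_eq_mul_prod_real, mul_div_cancel_left₀ _ hk0.ne']
      refine Finset.prod_le_prod_of_subset_of_le_one ?_ ?_ ?_
      · intro p hp
        rw [Finset.mem_filter] at hp
        exact Nat.mem_primeFactors.2 ⟨hP p hp.1, hp.2, hk.ne'⟩
      · exact fun p hp => (hfac p (Nat.prime_of_mem_primeFactors hp)).1
      · exact fun p hp _ => (hfac p (Nat.prime_of_mem_primeFactors hp)).2
    have h2 : 0 ≤ ∏ p ∈ P with ¬ p ∣ k, (1 - 1 / (p : ℝ)) :=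
      Finset.prod_nonneg fun p hp => (hfac p (hP p (Finset.mem_filter.1 hp).1)).1
    rw [← Finset.prod_filter_mul_prod_filter_not P (· ∣ k)]
    calc F / k * ∏ p ∈ P with ¬ p ∣ k, (1 - 1 / (p : ℝ))
        = F / (Nat.totient k : ℝ) * ((Nat.totient k : ℝ) / k *
          ∏ p ∈ P with ¬ p ∣ k, (1 - 1 / (p : ℝ))) := by field_simp
      _ ≤ _ := by gcongr
  have hE0 := h.nonneg_error
  have hcount : E * (2 ^ (P.filter fun p => ¬ p ∣ k).card + (P.filter fun p => ¬ p ∣ k).card) ≤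
      F / (Nat.totient k : ℝ) * ((2 ^ P.card + P.card) * X) := by
    have h3 : E ≤ F / (Nat.totient k : ℝ) * X := by
      have hE1 : E = (F * X) / k := by rw [hE]; ring
      have h4 : 0 ≤ F * X := by
        rw [hE1] at hE0
        rcases lt_or_ge (F * X) 0 with h5 | h5
        · exact absurd hE0 (not_le.2 (div_neg_of_neg_of_pos h5 hk0))
        · exact h5
      rw [hE1, div_mul_eq_mul_div]
      gcongr
    calc _ ≤ E * (2 ^ P.card + P.card) := by
          gcongr
          norm_num
      _ ≤ F / (Nat.totient k : ℝ) * X * (2 ^ P.card + P.card) := by gcongr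
      _ = _ := by ring
  linarith

theorem weightedPrimeSum_lt_of_log_le (h : IsEquidistributed J w F E) {k : ℕ} (l : ℕ) (hk : 0 < k)
    (hF : 0 < F) {L : ℝ} (hL : 0 < L) (hE : E = F / k * Real.exp (-L)) (hL' : L ≤ 15.5) :
    weightedPrimeSum J w k l < F / (Nat.totient k : ℝ) * (3 / L) := by
  have hφ0 : (0 : ℝ) < Nat.totient k := by exact_mod_cast Nat.totient_pos.2 hk
  -- On n ≤ L ≤ M, e^(-L) is largest at n and 3/L smallest at M, so a sieving set P works once one
  -- numerical inequality holds. The exponent n is an integer, hence the range from 2.6 to 3 still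
  -- uses n = 2.
  have main : ∀ (P : Finset ℕ) (n : ℕ) (M : ℝ), (∀ p ∈ P, p.Prime) → (n : ℝ) ≤ L → L ≤ M →
      (∏ p ∈ P, (1 - 1 / (p : ℝ)) + (2 ^ P.card + P.card) * (1 / 2.718) ^ n) < 3 / M →
      weightedPrimeSum J w k l < F / (Nat.totient k : ℝ) * (3 / L) := by
    intro P n M hP hn hM hlt
    refine (h.weightedPrimeSum_le_mul_prod l hk hF.le hE P hP).trans_lt ?_
    refine mul_lt_mul_of_pos_left ?_ (by positivity)
    have h1 := exp_neg_le_pow hn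
    have h2 : 3 / M ≤ 3 / L := by gcongr
    have h3 : ((2 : ℝ) ^ P.card + P.card) * Real.exp (-L) ≤
        (2 ^ P.card + P.card) * (1 / 2.718) ^ n := by gcongr
    linarith
  rcases le_total L 1 with h1 | h1
  · exact main ∅ 0 1 (by simp) (by simpa using hL.le) h1 (by norm_num)
  rcases le_total L 2 with h2 | h2
  · exact main ∅ 1 2 (by simp) (by simpa using h1) h2 (by norm_num)
  rcases le_total L 2.6 with h3 | h3
  · exact main ∅ 2 2.6 (by simp) (by simpa using h2) h3 (by norm_num)
  rcases le_total L 3 with h4 | h4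
  · exact main {2} 2 3 (by norm_num) (by simpa using h2) h4 (by norm_num)
  rcases le_total L 4 with h5 | h5
  · exact main {2} 3 4 (by norm_num) (by simpa using h4) h5 (by norm_num)
  rcases le_total L 5 with h6 | h6
  · exact main {2} 4 5 (by norm_num) (by simpa using h5) h6 (by norm_num)
  rcases le_total L 7 with h7 | h7
  · exact main {2, 3} 5 7 (by norm_num) (by simpa using h6) h7 (by norm_num)
  rcases le_total L 11 with h8 | h8
  · exact main {2, 3, 5, 7, 11, 13} 7 11 (by norm_num) (by simpa using h7) h8 (by norm_num)
  · exact main {2, 3, 5, 7, 11, 13} 11 15.5 (by norm_num) (by simpa using h8) hL' (by norm_num)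

/-- Primes in a residue class to an odd modulus lie in a class to the doubled modulus. -/
theorem exists_even_modulus (h : IsEquidistributed J w F E) {k : ℕ} (l : ℕ) (hk : 0 < k) :
    ∃ k' l' : ℕ, 0 < k' ∧ 2 ∣ k' ∧ Nat.totient k' = Nat.totient k ∧
      weightedPrimeSum J w k l ≤ weightedPrimeSum J w k' l' + E := by
  have hE := h.nonneg_error
  rcases Nat.even_or_odd k with hev | hodd
  · exact ⟨k, l, hk, hev.two_dvd, rfl, by linarith⟩
  · obtain ⟨r, hr1, hr2⟩ := Nat.chineseRemainder (Nat.coprime_two_left.2 hodd) 1 l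
    refine ⟨2 * k, r, by omega, dvd_mul_right 2 k, Nat.totient_two_mul_of_odd hodd, ?_⟩
    rw [weightedPrimeSum, ← Finset.sum_filter_add_sum_filter_not _ (fun p => p ≠ 2)]
    refine add_le_add ?_ ?_
    · refine Finset.sum_le_sum_of_subset_of_nonneg ?_ fun p hp _ =>
        h.nonneg p (Finset.mem_filter.1 hp).1
      intro p hp
      simp only [Finset.mem_filter] at hp ⊢
      refine ⟨hp.1.1, hp.1.2.1, ?_⟩
      rw [← Nat.modEq_and_modEq_iff_modEq_mul (Nat.coprime_two_left.2 hodd)]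
      refine ⟨Nat.ModEq.trans ?_ hr1.symm, hp.1.2.2.trans hr2.symm⟩
      exact Nat.odd_iff.1 (hp.1.2.1.odd_of_ne_two hp.2)
    · calc _ ≤ ∑ p ∈ (J.filter fun p => p.Prime ∧ p ≡ l [MOD k]) with ¬ p ≠ 2, E :=
            Finset.sum_le_sum fun p hp =>
              h.le p (Finset.mem_filter.1 (Finset.mem_filter.1 hp).1).1
        _ ≤ ∑ p ∈ ({2} : Finset ℕ), E := by
            refine Finset.sum_le_sum_of_subset_of_nonneg ?_ fun _ _ _ => hE
            intro p hp
            simpa using (Finset.mem_filter.1 hp).2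
        _ = E := by simp

/-- Selberg's sieve at z = e^t. The shift 4 in L = 2t + 4 turns the remainder into e^(-4)·C²/t² with
C² ≤ 9.87·e, about 0.5/t². The primes up to z and the prime 2 lost by doubling the modulus add at
most 0.04/t². -/
theorem weightedPrimeSum_le_of_le_log (h : IsEquidistributed J w F E) {k : ℕ} (l : ℕ) (hk : 0 < k)
    (hF : 0 < F) {t : ℝ} (ht : 5.75 ≤ t) (hE : E = F / k * Real.exp (-(2 * t + 4))) :
    weightedPrimeSum J w k l ≤ F / (Nat.totient k : ℝ) * (1 / t + 0.54 / t ^ 2) := by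
  have ht0 : 0 < t := by linarith
  have hk0 : (0 : ℝ) < k := by exact_mod_cast hk
  have hφ0 : (0 : ℝ) < Nat.totient k := by exact_mod_cast Nat.totient_pos.2 hk
  have hφk : (Nat.totient k : ℝ) ≤ k := by exact_mod_cast Nat.totient_le k
  have hE0 := h.nonneg_error
  obtain ⟨k', l', hk', h2, hφ, hle⟩ := h.exists_even_modulus l hk
  set z := Real.exp t with hz
  have hz1 : 1 < z := Real.one_lt_exp_iff.2 ht0
  have hlogz : Real.log z = t := Real.log_exp t
  set N := ⌊z⌋₊ with hN
  have hN1 : 1 ≤ N := Nat.le_floor (by exact_mod_cast hz1.le)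
  have hNz : (N : ℝ) ≤ z := Nat.floor_le (by positivity)
  have hzN : z < N + 1 := Nat.lt_floor_add_one z
  have hS := selbergSum_pos (k := k') hN1
  have hk'0 : (0 : ℝ) < k' := by exact_mod_cast hk'
  have key := h.weightedPrimeSum_le_selberg l' hk' hN1
  have hmain : F / (k' * selbergSum N k') ≤ F / (Nat.totient k : ℝ) * (1 / t) := by
    have h1 := log_le_mul_selbergSum N hk'
    have h3 : t ≤ Real.log (N + 1) := by
      rw [← hlogz]; exact Real.log_le_log (by positivity) hzN.le
    rw [hφ] at h1
    have h4 : (Nat.totient k : ℝ) * t ≤ k' * selbergSum N k' := by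
      have := h3.trans h1
      rw [div_mul_eq_mul_div, le_div_iff₀ hφ0] at this
      linarith
    rw [div_mul_div_comm, mul_one]
    gcongr
  have hH := selbergErrorSum_div_selbergSum_le hN1 h2 hNz hz1
  rw [hlogz] at hH
  have hH0 : 0 ≤ selbergErrorSum N k' / selbergSum N k' :=
    div_nonneg (Finset.sum_nonneg fun n _ => sigmaDivTotient_nonneg n) hS.le
  have hsq : (selbergErrorSum N k' / selbergSum N k') ^ 2 ≤
      (2 * Real.log 4 + 1 / Real.exp 1) ^ 2 * Real.exp 1 * (z ^ 2 / t ^ 2) := by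
    calc _ ≤ ((2 * Real.log 4 + 1 / Real.exp 1) * Real.exp (1 / 2) * (z / t)) ^ 2 :=
          pow_le_pow_left₀ hH0 hH 2
      _ = (2 * Real.log 4 + 1 / Real.exp 1) ^ 2 * Real.exp (1 / 2) ^ 2 * (z ^ 2 / t ^ 2) := by
          ring
      _ = _ := by rw [← Real.exp_nat_mul]; norm_num
  have hC : (2 * Real.log 4 + 1 / Real.exp 1) ^ 2 ≤ 9.87 := by
    have he : (2.718 : ℝ) ≤ Real.exp 1 := by have := Real.exp_one_gt_d9; linarith
    have h4 : Real.log 4 = 2 * Real.log 2 := by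
      rw [show (4 : ℝ) = 2 ^ 2 by norm_num, Real.log_pow]; norm_num
    have h5 := Real.log_two_lt_d9
    have h6 : 0 < Real.log 2 := Real.log_pos (by norm_num)
    have h7 : 1 / Real.exp 1 ≤ 1 / 2.718 := by gcongr
    calc (2 * Real.log 4 + 1 / Real.exp 1) ^ 2 ≤ (2 * (2 * 0.6931471808) + 1 / 2.718) ^ 2 := by
          rw [h4]
          have : 0 < 1 / Real.exp 1 := by positivity
          gcongr
      _ ≤ 9.87 := by norm_num
  have hexp : Real.exp (-(2 * t + 4)) * z ^ 2 * Real.exp 1 = Real.exp (-3) := by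
    rw [hz, ← Real.exp_nat_mul, ← Real.exp_add, ← Real.exp_add]
    congr 1; push_cast; ring
  have hexp3 : Real.exp (-3) ≤ (1 / 2.718) ^ 3 := exp_neg_le_pow (by norm_num)
  -- Here z + 1 ≤ 2z and z ≥ t³/6, so the term decays like t⁻³; t ≥ 5.75 turns the spare power into
  -- the constant 0.04.
  have hexp' : Real.exp (-(2 * t + 4)) * (z + 1) ≤ 0.04 / t ^ 2 := by
    have h8 : t ^ 3 / 6 ≤ z := by
      have := Real.pow_div_factorial_le_exp t ht0.le 3
      simpa [Nat.factorial] using this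
    have h9 : Real.exp (-(2 * t + 4)) * z ^ 2 = Real.exp (-4) := by
      rw [hz, ← Real.exp_nat_mul, ← Real.exp_add]; congr 1; push_cast; ring
    have h10 : Real.exp (-4) ≤ (1 / 2.718) ^ 4 := exp_neg_le_pow (by norm_num)
    have h11 : Real.exp (-(2 * t + 4)) * (z + 1) ≤ 2 * Real.exp (-4) / z := by
      rw [le_div_iff₀ (by positivity), ← h9]
      have := Real.exp_pos (-(2 * t + 4))
      nlinarith [mul_pos this (by positivity : 0 < z)]
    calc _ ≤ 2 * Real.exp (-4) / z := h11
      _ ≤ 2 * (1 / 2.718) ^ 4 / (t ^ 3 / 6) := by gcongr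
      _ = 12 * (1 / 2.718) ^ 4 / t / t ^ 2 := by field_simp; norm_num
      _ ≤ 12 * (1 / 2.718) ^ 4 / 5.75 / t ^ 2 := by gcongr
      _ ≤ 0.04 / t ^ 2 := by gcongr; norm_num
  have herr : E * ((selbergErrorSum N k' / selbergSum N k') ^ 2 + N) + E ≤
      F / (Nat.totient k : ℝ) * (0.54 / t ^ 2) := by
    have h12 : Real.exp (-(2 * t + 4)) *
        ((selbergErrorSum N k' / selbergSum N k') ^ 2 + N + 1) ≤ 0.54 / t ^ 2 := by
      calc _ ≤ Real.exp (-(2 * t + 4)) * ((2 * Real.log 4 + 1 / Real.exp 1) ^ 2 * Real.exp 1 *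
            (z ^ 2 / t ^ 2) + z + 1) := by gcongr
        _ = (Real.exp (-(2 * t + 4)) * z ^ 2 * Real.exp 1) *
            (2 * Real.log 4 + 1 / Real.exp 1) ^ 2 / t ^ 2 +
            Real.exp (-(2 * t + 4)) * (z + 1) := by ring
        _ ≤ (1 / 2.718) ^ 3 * 9.87 / t ^ 2 + 0.04 / t ^ 2 := by
            rw [hexp]
            gcongr
        _ = ((1 / 2.718) ^ 3 * 9.87 + 0.04) / t ^ 2 := by ring
        _ ≤ 0.54 / t ^ 2 := by gcongr; norm_num
    have h13 : F / k ≤ F / (Nat.totient k : ℝ) := by gcongr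
    calc _ = F / k * (Real.exp (-(2 * t + 4)) *
          ((selbergErrorSum N k' / selbergSum N k') ^ 2 + N + 1)) := by
          conv_lhs => rw [hE]
          ring
      _ ≤ F / k * (0.54 / t ^ 2) := by gcongr
      _ ≤ _ := by gcongr
  calc _ ≤ _ := hle
    _ ≤ F / (k' * selbergSum N k') +
        (E * ((selbergErrorSum N k' / selbergSum N k') ^ 2 + N) + E) := by linarith
    _ ≤ F / (Nat.totient k : ℝ) * (1 / t) + F / (Nat.totient k : ℝ) * (0.54 / t ^ 2) :=
        add_le_add hmain herr
    _ = _ := by ring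

/-- The Brun–Titchmarsh inequality for equidistributed weights. -/
theorem weightedPrimeSum_lt (h : IsEquidistributed J w F E) {k : ℕ} (l : ℕ) (hk : 0 < k)
    (hF : 0 < F) {L : ℝ} (hL : 0 < L) (hE : E = F / k * Real.exp (-L)) :
    weightedPrimeSum J w k l < F / (Nat.totient k : ℝ) * (2 / L * (1 + 8 / L)) ∧
      weightedPrimeSum J w k l < F / (Nat.totient k : ℝ) * (3 / L) := by
  have hφ0 : (0 : ℝ) < Nat.totient k := by exact_mod_cast Nat.totient_pos.2 hk
  have hA : 0 < F / (Nat.totient k : ℝ) := by positivity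
  rcases le_total L 15.5 with h1 | h1
  · have h2 := h.weightedPrimeSum_lt_of_log_le l hk hF hL hE h1
    refine ⟨h2.trans_le (mul_le_mul_of_nonneg_left ?_ hA.le), h2⟩
    rw [show 2 / L * (1 + 8 / L) = (2 * (1 + 8 / L)) / L by ring]
    gcongr
    -- This is 2(1 + 8/L) ≥ 3, valid up to L = 16.
    have : 1 / 2 ≤ 8 / L := by rw [le_div_iff₀ hL]; linarith
    linarith
  · obtain ⟨t, rfl⟩ : ∃ t, L = 2 * t + 4 := ⟨(L - 4) / 2, by ring⟩
    have ht : 5.75 ≤ t := by linarith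
    have ht0 : 0 < t := by linarith
    have h2 := h.weightedPrimeSum_le_of_le_log l hk hF ht hE
    have e : 1 / t + 0.54 / t ^ 2 = (t + 0.54) / t ^ 2 := by field_simp
    rw [e] at h2
    refine ⟨h2.trans_lt (mul_lt_mul_of_pos_left ?_ hA), h2.trans_lt (mul_lt_mul_of_pos_left ?_ hA)⟩
    · rw [show 2 / (2 * t + 4) * (1 + 8 / (2 * t + 4)) = (t + 6) / (t + 2) ^ 2 by
        field_simp; ring]
      rw [div_lt_div_iff₀ (by positivity) (by positivity)]
      -- After cancelling t³ this says 1.46t² > 6.16t + 2.16. The bound with 3/L below needs t² >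
      -- 5.08t + 2.16, which is the tighter constraint behind the threshold 5.75.
      nlinarith [mul_nonneg (sub_nonneg.2 ht) ht0.le]
    · rw [div_lt_div_iff₀ (by positivity) (by positivity)]
      nlinarith [mul_nonneg (sub_nonneg.2 ht) ht0.le]

end IsEquidistributed

/-! ### Transfer to W^{1,1} weights and to π(t; k, l) -/

theorem norm1_nonneg (a b : ℝ) (f : ℝ → ℝ) : 0 ≤ norm1 a b f :=
  integral_nonneg fun _ => abs_nonneg _

theorem normSup_nonneg (a b : ℝ) (f : ℝ → ℝ) : 0 ≤ normSup a b f :=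
  Real.sSup_nonneg (by rintro _ ⟨t, _, rfl⟩; exact abs_nonneg _)

theorem MemW11.hasW11Deriv {a b : ℝ} {f : ℝ → ℝ} (h : MemW11 a b f) :
    HasW11Deriv a b f (w11Deriv a b f) := by
  rw [w11Deriv, dif_pos h]
  exact h.choose_spec

theorem MemW11.isEquidistributed {a b : ℝ} {f : ℝ → ℝ} (ha : 0 ≤ a) (hab : a < b)
    (h : MemW11 a b f) (hf : ∀ t ∈ Set.Icc a b, 0 ≤ f t) :
    IsEquidistributed (Finset.Icc ⌈a⌉₊ ⌊b⌋₊) (fun n => f n) (norm1 a b f)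
      (normSup a b f + norm1 a b (w11Deriv a b f)) := by
  have mem : ∀ n ∈ Finset.Icc ⌈a⌉₊ ⌊b⌋₊, (n : ℝ) ∈ Set.Icc a b := by
    intro n hn
    rw [Finset.mem_Icc] at hn
    exact ⟨Nat.ceil_le.1 hn.1, (Nat.le_floor_iff (ha.trans hab.le)).1 hn.2⟩
  have hn0 := norm1_nonneg a b (w11Deriv a b f)
  refine ⟨fun n hn => hf n (mem n hn), fun n hn => ?_, fun q c hq => ?_,
    add_nonneg (normSup_nonneg a b f) hn0⟩
  · linarith [le_abs_self (f n), abs_le_normSup h.hasW11Deriv.continuousOn (mem n hn)]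
  · have e : norm1 a b f = ∫ t in Set.Icc a b, f t :=
      setIntegral_congr_fun measurableSet_Icc fun t ht => abs_of_nonneg (hf t ht)
    rw [e]
    exact h.hasW11Deriv.abs_sum_modEq_sub_le ha hab q c hq

theorem primeSum_lt {a b : ℝ} {f : ℝ → ℝ} (ha : 0 ≤ a) {k : ℕ} (l : ℕ) (hk : 0 < k)
    (h : MemW11 a b f) (hf : ∀ t ∈ Set.Icc a b, 0 ≤ f t) (hρ : (k : ℝ) < rho a b f) :
    primeSum a b k l f < 2 * (norm1 a b f /
        ((Nat.totient k : ℝ) * Real.log (rho a b f / k))) * (1 + 8 / Real.log (rho a b f / k)) ∧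
      primeSum a b k l f < 3 * (norm1 a b f /
        ((Nat.totient k : ℝ) * Real.log (rho a b f / k))) := by
  have hk0 : (0 : ℝ) < k := by exact_mod_cast hk
  have hρ0 : 0 < rho a b f := hk0.trans hρ
  -- With division by zero equal to 0, the hypothesis ρ > k > 0 alone excludes f = 0 and a
  -- degenerate interval.
  have hF : 0 < norm1 a b f := by
    refine lt_of_le_of_ne (norm1_nonneg a b f) fun h0 => ?_
    rw [rho, ← h0, zero_div] at hρ0
    exact lt_irrefl _ hρ0
  have hab : a < b := by
    by_contra! hba
    have : norm1 a b f = 0 := by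
      rw [norm1, integral_Icc_eq_integral_Ioc, Set.Ioc_eq_empty_of_le hba]; simp
    exact hF.ne' this
  set E := normSup a b f + norm1 a b (w11Deriv a b f) with hEdef
  have hrho : rho a b f = norm1 a b f / E := rfl
  have hE0 : E ≠ 0 := by
    intro h0
    rw [hrho, h0, div_zero] at hρ0
    exact lt_irrefl _ hρ0
  have hX : 1 < rho a b f / k := (one_lt_div hk0).2 hρ
  have hL := Real.log_pos hX
  have hE : E = norm1 a b f / k * Real.exp (-Real.log (rho a b f / k)) := by
    rw [Real.exp_neg, Real.exp_log (by linarith), hrho]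
    have := hF.ne'
    field_simp
  obtain ⟨h1, h2⟩ := (h.isEquidistributed ha hab hf).weightedPrimeSum_lt l hk hF hL hE
  have e1 : ∀ A φ L : ℝ, A / φ * (2 / L * (1 + 8 / L)) = 2 * (A / (φ * L)) * (1 + 8 / L) := by
    intro A φ L; rw [← div_div]; ring
  have e2 : ∀ A φ L : ℝ, A / φ * (3 / L) = 3 * (A / (φ * L)) := by
    intro A φ L; rw [← div_div]; ring
  rw [e1] at h1
  rw [e2] at h2
  exact ⟨h1, h2⟩

theorem hasW11Deriv_one (a b : ℝ) : HasW11Deriv a b (fun _ => 1) 0 where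
  continuousOn := continuousOn_const
  integrableOn := integrableOn_zero
  approx ε hε := ⟨fun _ => 1, contDiffOn_const, by simpa [norm1] using hε⟩

/-- The derivative inside ρ is an arbitrary choice of weak derivative; almost everywhere uniqueness
is what makes its norm vanish. -/
theorem rho_one {a b : ℝ} (hab : a ≤ b) : rho a b (fun _ => 1) = b - a := by
  have h1 : norm1 a b (fun _ => 1) = b - a := by simp [norm1, hab]
  have h2 : normSup a b (fun _ => 1) = 1 := by
    rw [normSup, (Set.nonempty_Icc.2 hab).image_const]
    simp
  have h3 : norm1 a b (w11Deriv a b fun _ => 1) = 0 := by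
    have hm : MemW11 a b (fun _ => 1) := ⟨0, hasW11Deriv_one a b⟩
    rw [norm1, integral_eq_zero_of_ae]
    filter_upwards [hm.hasW11Deriv.ae_unique (hasW11Deriv_one a b)] with t ht
    simp [ht]
  rw [rho, h1, h2, h3]
  simp

/-- Only an inequality: the difference counts primes in (x, x + y], while the sum also includes x
itself when it is such a prime. -/
theorem primePi_sub_le_primeSum_one (x y : ℝ) (k l : ℕ) :
    (primePi (x + y) k l : ℝ) - primePi x k l ≤ primeSum x (x + y) k l (fun _ => 1) := by
  have hle : primePi (x + y) k l ≤ primePi x k l +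
      ((Finset.Icc ⌈x⌉₊ ⌊x + y⌋₊).filter fun p => p.Prime ∧ p ≡ l [MOD k]).card := by
    unfold primePi
    refine (Finset.card_le_card ?_).trans (Finset.card_union_le _ _)
    intro p hp
    simp only [Finset.mem_filter, Finset.mem_union, Finset.mem_Icc] at hp ⊢
    rcases le_or_gt p ⌊x⌋₊ with h | h
    · exact Or.inl ⟨⟨hp.1.1, h⟩, hp.2⟩
    · exact Or.inr ⟨⟨(Nat.ceil_le_floor_add_one x).trans h, hp.1.2⟩, hp.2⟩
  have e : primeSum x (x + y) k l (fun _ => 1) =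
      ((Finset.Icc ⌈x⌉₊ ⌊x + y⌋₊).filter fun p => p.Prime ∧ p ≡ l [MOD k]).card := by
    simp [primeSum]
  rw [e, sub_le_iff_le_add']
  exact_mod_cast hle

end WeightedBT

theorem theoremt (x y : ℝ) (hx : 0 ≤ x) (hy : 0 ≤ y) (k l : ℕ) (hk : 0 < k)
    (hkl : Nat.Coprime l k) :
    (∀ f : ℝ → ℝ, WeightedBT.MemW11 x (x + y) f →
      (∀ t ∈ Set.Icc x (x + y), 0 ≤ f t) →
      (k : ℝ) < WeightedBT.rho x (x + y) f →
      WeightedBT.primeSum x (x + y) k l f <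
          2 * (WeightedBT.norm1 x (x + y) f /
            ((Nat.totient k : ℝ) * Real.log (WeightedBT.rho x (x + y) f / k))) *
            (1 + 8 / Real.log (WeightedBT.rho x (x + y) f / k)) ∧
      WeightedBT.primeSum x (x + y) k l f <
          3 * (WeightedBT.norm1 x (x + y) f /
            ((Nat.totient k : ℝ) * Real.log (WeightedBT.rho x (x + y) f / k)))) ∧
    ((k : ℝ) < y →
      (WeightedBT.primePi (x + y) k l : ℝ) - (WeightedBT.primePi x k l : ℝ) <
          2 * y / ((Nat.totient k : ℝ) * Real.log (y / k)) * (1 + 8 / Real.log (y / k))) := by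
  refine ⟨fun f hf hf0 hρ => WeightedBT.primeSum_lt hx l hk hf hf0 hρ, fun hky => ?_⟩
  have hxy : x ≤ x + y := by linarith
  have hρ : WeightedBT.rho x (x + y) (fun _ => 1) = y := by
    rw [WeightedBT.rho_one hxy, add_sub_cancel_left]
  have hn : WeightedBT.norm1 x (x + y) (fun _ => 1) = y := by simp [WeightedBT.norm1, hy]
  have h := (WeightedBT.primeSum_lt hx l hk ⟨0, WeightedBT.hasW11Deriv_one x (x + y)⟩
    (fun _ _ => zero_le_one) (by rw [hρ]; exact hky)).1
  rw [hρ, hn, ← mul_div_assoc] at h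
  exact (WeightedBT.primePi_sub_le_primeSum_one x y k l).trans_lt h
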